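/- Let $M$ be a smooth manifold, let $\nabla$ be a smooth connection on $M$ (that is, on $TM$, symmetric or not), and let $W$ be the vector bundle of symmetric covariant 2-tensors on $M$ (the symmetric elements of $T^*M\otimes T^*M$), with the connection induced by $\nabla$, again denoted $\nabla$, and its curvature tensor $R$. For a subset $V\subseteq W$ whose fibres are linear subspaces, let $\mathcal S(V)\subseteq V$ be the set of all $v\in V$ through which there passes a smooth local section of $W$, defined on an open set, with values in $V$. For a subset $W'\subseteq W$ with linear fibres and $\mathcal S(W')=W'$, let $\ker\alpha_{W'}$ be the kernel of its second fundamental 1-form $\alpha_{W'}:W'\to (W/W')\otimes T^*M$, i.e. the set of those $w\in W'_y$, $y\in M$, for which there is a smooth local section $X$ with values in $W'$, defined near $y$, with $X(y)=w$ and $(\nabla_vX)(y)\in W'_y$ for all $v\in T_yM$. Put $$V^{(0)}=\{w\in W : R(\cdot,\cdot)(w)=0\},\qquad W^{(i)}=\mathcal S(V^{(i)}),\qquad V^{(i+1)}=\ker\alpha_{W^{(i)}}\qquad(i\ge 0).$$ The sets $W^{(0)}\supseteq W^{(1)}\supseteq\cdots$ decrease and become stationary; let $\widetilde W=\bigcap_i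 W^{(i)}$ be the terminal one, and let $\widetilde W_x$ be its fibre at $x$. The connection $\nabla$ is called regular at $x$ if there is an open neighbourhood $U$ of $x$ over which $\widetilde W$ is a smooth vector bundle (near each point of $U$ there are finitely many smooth local sections of $W$ whose values form a basis of each fibre of $\widetilde W$). It is called locally metric at $x$ if there are an open neighbourhood $U$ of $x$ and a smooth (positive-definite) metric $g$ on $U$ with $\nabla g=0$ on $U$. Let $x\in M$ and let $\nabla$ be regular at $x$. Then $\nabla$ is locally metric at $x$ if and only if $\widetilde W_x$ contains a positive-definite bilinear form. -/

import Mathlib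

open Set Bundle FiberBundle
open scoped Manifold ContDiff Topology

noncomputable section

/-! ### The derived flag of a connection on a vector bundle -/

section Flag

variable {E : Type*} [NormedAddCommGroup E] [NormedSpace ℝ E]
  {H : Type*} [TopologicalSpace H] {I : ModelWithCorners ℝ E H}
  {M : Type*} [TopologicalSpace M] [ChartedSpace H M] [IsManifold I ∞ M]
  {F : Type*} [NormedAddCommGroup F] [NormedSpace ℝ F]
  {V : M → Type*} [TopologicalSpace (TotalSpace F V)]
  [∀ x, AddCommGroup (V x)] [∀ x, Module ℝ (V x)] [∀ x, TopologicalSpace (V x)]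
  [∀ x, IsTopologicalAddGroup (V x)] [∀ x, ContinuousSMul ℝ (V x)]
  [FiberBundle F V]

variable (I F) in
/-- `σ` is a smooth section over the open set `U` of the vector bundle `V`, with values over `U`
in the subset `A` of `V` (given by its fibres `A x`). Off `U`, the values of `σ` are irrelevant. -/
def IsSmoothLocalSection (A : ∀ x : M, Set (V x)) (U : Set M) (σ : ∀ x : M, V x) : Prop :=
  IsOpen U ∧ CMDiff[U] ∞ (T% σ) ∧ ∀ y ∈ U, σ y ∈ A y

variable (I F) in
/-- The subset `𝒮(A)` of `A`: all elements of `A` through which there passes a smooth local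
section of the bundle with values in `A`. -/
def sectionPart (A : ∀ x : M, Set (V x)) (x : M) : Set (V x) :=
  {w | ∃ (U : Set M) (σ : ∀ y : M, V y), x ∈ U ∧ IsSmoothLocalSection I F A U σ ∧ σ x = w}

/-- `R(X, Y)σ = ∇_X ∇_Y σ - ∇_Y ∇_X σ - ∇_[X, Y] σ` at the point `x`. -/
def curvatureAt (cov : CovariantDerivative I F V) (X Y : ∀ x : M, TangentSpace I x)
    (σ : ∀ x : M, V x) (x : M) : V x :=
  cov (fun y ↦ cov σ y (Y y)) x (X x) - cov (fun y ↦ cov σ y (X y)) x (Y x)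
    - cov σ x (VectorField.mlieBracket I X Y x)

/-- The elements `w` of the subset `W` of `V` with `R(u, v)w = 0` for all tangent vectors `u, v`.
As `R` is a tensor, `R(u, v)w` is computed by extending `u`, `v`, `w` to smooth local sections. -/
def curvatureKernel (cov : CovariantDerivative I F V) (W : ∀ x : M, Set (V x)) (x : M) :
    Set (V x) :=
  {w | w ∈ W x ∧ ∀ (U : Set M) (X Y : ∀ y : M, TangentSpace I y) (σ : ∀ y : M, V y),
    IsOpen U → x ∈ U → CMDiff[U] ∞ (T% X) → CMDiff[U] ∞ (T% Y) → CMDiff[U] ∞ (T% σ) →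
      σ x = w → curvatureAt cov X Y σ x = 0}

/-- The kernel of the second fundamental 1-form `α : A → (V / A) ⊗ T*M` of a subset `A` of `V`
whose fibres are linear subspaces: `α` sends `w ∈ A x` to the class of `∇σ` at `x` modulo
`A x ⊗ T*M`, where `σ` is a smooth local section with values in `A` and with `σ x = w`. So `w`
lies in the kernel if and only if `∇_v σ ∈ A x` for all tangent vectors `v` at `x`. -/
def secondFundamentalKernel (cov : CovariantDerivative I F V) (A : ∀ x : M, Set (V x)) (x : M) :
    Set (V x) :=
  {w | ∃ (U : Set M) (σ : ∀ y : M, V y), x ∈ U ∧ IsSmoothLocalSection I F A U σ ∧ σ x = w ∧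
    ∀ v : TangentSpace I x, cov σ x v ∈ A x}

/-- The derived flag `W ⊇ W⁽⁰⁾ ⊇ W⁽¹⁾ ⊇ ⋯`, where `W` is a (`∇`-invariant) subbundle of `V`:
`W⁽⁰⁾ = 𝒮(V⁽⁰⁾)` with `V⁽⁰⁾ = {w ∈ W | R(·,·)w = 0}`, and `W⁽ⁱ⁺¹⁾ = 𝒮(V⁽ⁱ⁺¹⁾)`, where `V⁽ⁱ⁺¹⁾`
is the kernel of the second fundamental 1-form of `W⁽ⁱ⁾`. -/
def derivedFlag (cov : CovariantDerivative I F V) (W : ∀ x : M, Set (V x)) :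
    ℕ → ∀ x : M, Set (V x)
  | 0 => sectionPart I F (curvatureKernel cov W)
  | i + 1 => sectionPart I F (secondFundamentalKernel cov (derivedFlag cov W i))

/-- The terminal subset `W̃` of the derived flag. The flag is decreasing, so its intersection
is the set `W⁽ᵏ⁾` at which it becomes stationary. -/
def terminalSubset (cov : CovariantDerivative I F V) (W : ∀ x : M, Set (V x)) (x : M) :
    Set (V x) :=
  ⋂ i, derivedFlag cov W i x

lemma derivedFlag_succ_subset (cov : CovariantDerivative I F V) (W : ∀ x : M, Set (V x))
    (i : ℕ) (x : M) : derivedFlag cov W (i + 1) x ⊆ derivedFlag cov W i x := by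
  rintro w ⟨U, σ, hx, ⟨-, -, hσ⟩, rfl⟩
  obtain ⟨U', τ, hx', ⟨-, -, hτ⟩, h, -⟩ := hσ x hx
  exact h ▸ hτ x hx'

lemma terminalSubset_eq (cov : CovariantDerivative I F V) (W : ∀ x : M, Set (V x))
    (k : ℕ) (hk : ∀ l ≥ k, derivedFlag cov W l = derivedFlag cov W k) :
    terminalSubset cov W = derivedFlag cov W k := by
  funext x
  refine Subset.antisymm (iInter_subset _ k) (subset_iInter fun i ↦ ?_)
  rcases le_total k i with h | h
  · rw [hk i h]
  · exact antitone_nat_of_succ_le (f := fun i ↦ derivedFlag cov W i x)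
      (fun i ↦ derivedFlag_succ_subset cov W i x) h

variable (I F) in
/-- The subset `A` of `V` is a (smooth) vector bundle over the open set `U`: near every point of
`U` there are finitely many smooth sections of `V` whose values form bases of the fibres of `A`. -/
def IsVectorBundleOver (A : ∀ x : M, Set (V x)) (U : Set M) : Prop :=
  ∀ y ∈ U, ∃ (U' : Set M) (r : ℕ) (X : Fin r → ∀ z : M, V z), IsOpen U' ∧ y ∈ U' ∧
    (∀ j, CMDiff[U'] ∞ (T% (X j))) ∧
    ∀ z ∈ U', LinearIndependent ℝ (fun j ↦ X j z) ∧
      A z = (Submodule.span ℝ (range fun j ↦ X j z) : Set (V z))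

/-- The connection is regular at `x` (with respect to `W`): `W̃` is a vector bundle over some
neighbourhood of `x`. -/
def IsRegularConnectionAt (cov : CovariantDerivative I F V) (W : ∀ x : M, Set (V x)) (x : M) :
    Prop :=
  ∃ U : Set M, IsOpen U ∧ x ∈ U ∧ IsVectorBundleOver I F (terminalSubset cov W) U

end Flag

/-! ### The bundle of covariant 2-tensors -/

section Tensors

variable {E : Type*} [NormedAddCommGroup E] [NormedSpace ℝ E]
  {H : Type*} [TopologicalSpace H] {I : ModelWithCorners ℝ E H}
  {M : Type*} [TopologicalSpace M] [ChartedSpace H M]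

/-! Shortcuts for instance search. -/

instance cotangentSpace_isTopologicalAddGroup (x : M) :
    IsTopologicalAddGroup (TangentSpace I x →L[ℝ] ℝ) :=
  ContinuousLinearMap.topologicalAddGroup

instance cotangentSpace_continuousSMul (x : M) : ContinuousSMul ℝ (TangentSpace I x →L[ℝ] ℝ) :=
  ContinuousLinearMap.continuousSMul

instance cotangentSpace_continuousAdd (x : M) : ContinuousAdd (TangentSpace I x →L[ℝ] ℝ) :=
  inferInstance

variable (I) in
/-- The fibre at `x` of the bundle `T*M ⊗ T*M`: the bilinear forms on the tangent space. -/
abbrev BilinearFormAt (x : M) : Type _ :=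
  TangentSpace I x →L[ℝ] TangentSpace I x →L[ℝ] ℝ

variable (I M) in
/-- The bundle `W` of symmetric covariant 2-tensors, as a subset of `T*M ⊗ T*M`. -/
def symmetricForms (x : M) : Set (BilinearFormAt I x) :=
  {h | ∀ v w : TangentSpace I x, h v w = h w v}

/-- Positive-definiteness of a bilinear form on a tangent space. -/
def IsPositiveDefinite {x : M} (h : BilinearFormAt I x) : Prop :=
  ∀ v : TangentSpace I x, v ≠ 0 → 0 < h v v

variable [IsManifold I ∞ M]
variable (cov : CovariantDerivative I E (TangentSpace I : M → Type _))

/-- `(∇_v h)(Y, Z) = v(h(Y, Z)) - h(∇_v Y, Z) - h(Y, ∇_v Z)` at the point `x`. -/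
def tensorDerivAux (h : ∀ x : M, BilinearFormAt I x) (x : M) (v : TangentSpace I x)
    (Y Z : ∀ x : M, TangentSpace I x) : ℝ :=
  d% (fun y ↦ h y (Y y) (Z y)) x v - h x (cov Y x v) (Z x) - h x (Y x) (cov Z x v)

variable {h h' : ∀ x : M, BilinearFormAt I x} {x : M}

lemma mdifferentiableAt_pairing
    (hh : MDiffAt (fun y ↦ TotalSpace.mk' (E →L[ℝ] E →L[ℝ] ℝ) y (h y)) x)
    {Y Z : ∀ x : M, TangentSpace I x} (hY : MDiffAt (T% Y) x) (hZ : MDiffAt (T% Z) x) :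
    MDiffAt (fun y ↦ h y (Y y) (Z y)) x := by
  have : MDifferentiableAt I (I.prod 𝓘(ℝ))
      (fun m ↦ TotalSpace.mk' ℝ (E := Bundle.Trivial M ℝ) m (h m (Y m) (Z m))) x := by
    apply MDifferentiableAt.clm_bundle_apply₂ (F₁ := E) (F₂ := E)
    · exact hh
    · exact hY
    · exact hZ
  simp only [mdifferentiableAt_totalSpace] at this
  exact this.2

lemma tensorialAt_tensorDerivAux₁
    (hh : MDiffAt (fun y ↦ TotalSpace.mk' (E →L[ℝ] E →L[ℝ] ℝ) y (h y)) x)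
    (v : TangentSpace I x) (Z : ∀ x : M, TangentSpace I x) (hZ : MDiffAt (T% Z) x) :
    TensorialAt I E (tensorDerivAux cov h x v · Z) x where
  smul {f Y} hf hY := by
    have e : (fun y ↦ h y ((f • Y) y) (Z y)) = fun y ↦ f y * h y (Y y) (Z y) := by
      funext y; simp
    simp only [tensorDerivAux, e]
    simp [mvfderiv_fun_mul hf (mdifferentiableAt_pairing hh hY hZ),
      cov.isCovariantDerivativeOn.leibniz hY hf]
    ring
  add {Y Y'} hY hY' := by
    have e : (fun y ↦ h y ((Y + Y') y) (Z y)) = fun y ↦ h y (Y y) (Z y) + h y (Y' y) (Z y) := by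
      funext y; simp
    simp only [tensorDerivAux, e]
    simp [mvfderiv_fun_add (mdifferentiableAt_pairing hh hY hZ)
        (mdifferentiableAt_pairing hh hY' hZ), cov.isCovariantDerivativeOn.add hY hY']
    ring

lemma tensorialAt_tensorDerivAux₂
    (hh : MDiffAt (fun y ↦ TotalSpace.mk' (E →L[ℝ] E →L[ℝ] ℝ) y (h y)) x)
    (v : TangentSpace I x) (Y : ∀ x : M, TangentSpace I x) (hY : MDiffAt (T% Y) x) :
    TensorialAt I E (tensorDerivAux cov h x v Y) x where
  smul {f Z} hf hZ := by
    have e : (fun y ↦ h y (Y y) ((f • Z) y)) = fun y ↦ f y * h y (Y y) (Z y) := by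
      funext y; simp
    simp only [tensorDerivAux, e]
    simp [mvfderiv_fun_mul hf (mdifferentiableAt_pairing hh hY hZ),
      cov.isCovariantDerivativeOn.leibniz hZ hf]
    ring
  add {Z Z'} hZ hZ' := by
    have e : (fun y ↦ h y (Y y) ((Z + Z') y)) = fun y ↦ h y (Y y) (Z y) + h y (Y y) (Z' y) := by
      funext y; simp
    simp only [tensorDerivAux, e]
    simp [mvfderiv_fun_add (mdifferentiableAt_pairing hh hY hZ)
        (mdifferentiableAt_pairing hh hY hZ'), cov.isCovariantDerivativeOn.add hZ hZ']
    ring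

variable [FiniteDimensional ℝ E]

set_option synthInstance.maxHeartbeats 200000 in
/-- The covariant derivative `v ↦ ∇_v h` at `x` of a covariant 2-tensor `h` which is
differentiable at `x`. -/
def tensorDeriv (h : ∀ x : M, BilinearFormAt I x) (x : M)
    (hh : MDiffAt (fun y ↦ TotalSpace.mk' (E →L[ℝ] E →L[ℝ] ℝ) y (h y)) x) :
    TangentSpace I x →L[ℝ] BilinearFormAt I x :=
  have : T2Space (TangentSpace I x) := FiberBundle.t2Space E (TangentSpace I) x
  have : FiniteDimensional ℝ (TangentSpace I x) :=
    VectorBundle.finiteDimensional ℝ E (TangentSpace I) x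
  LinearMap.toContinuousLinearMap
    { toFun := fun v ↦ TensorialAt.mkHom₂ (tensorDerivAux cov h x v) x
        (tensorialAt_tensorDerivAux₁ cov hh v) (tensorialAt_tensorDerivAux₂ cov hh v)
      map_add' := fun v w ↦ by
        ext a b
        simp [TensorialAt.mkHom₂_apply_eq_extend, tensorDerivAux]
        ring
      map_smul' := fun c v ↦ by
        ext a b
        simp [TensorialAt.mkHom₂_apply_eq_extend, tensorDerivAux]
        ring }

lemma tensorDeriv_apply
    (hh : MDiffAt (fun y ↦ TotalSpace.mk' (E →L[ℝ] E →L[ℝ] ℝ) y (h y)) x)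
    (v : TangentSpace I x)
    {Y Z : ∀ x : M, TangentSpace I x} (hY : MDiffAt (T% Y) x) (hZ : MDiffAt (T% Z) x) :
    tensorDeriv cov h x hh v (Y x) (Z x) =
      d% (fun y ↦ h y (Y y) (Z y)) x v - h x (cov Y x v) (Z x) - h x (Y x) (cov Z x v) :=
  TensorialAt.mkHom₂_apply (tensorialAt_tensorDerivAux₁ cov hh v)
    (tensorialAt_tensorDerivAux₂ cov hh v) hY hZ

open scoped Classical in
/-- The connection on the bundle `T*M ⊗ T*M` induced by a connection on `M`, given by
`(∇_v h)(Y, Z) = v(h(Y, Z)) - h(∇_v Y, Z) - h(Y, ∇_v Z)`. -/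
def tensorConnection :
    CovariantDerivative I (E →L[ℝ] E →L[ℝ] ℝ) (BilinearFormAt I : M → Type _) where
  toFun h x :=
    if hh : MDiffAt (fun y ↦ TotalSpace.mk' (E →L[ℝ] E →L[ℝ] ℝ) y (h y)) x then
      tensorDeriv cov h x hh else 0
  isCovariantDerivativeOnUniv :=
    { add := by
        intro h h' x hh hh' _
        have hs : MDiffAt (fun y ↦ TotalSpace.mk' (E →L[ℝ] E →L[ℝ] ℝ) y ((h + h') y)) x :=
          mdifferentiableAt_add_section hh hh'
        rw [dif_pos hs, dif_pos hh, dif_pos hh']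
        ext v a b
        have ha := mdifferentiableAt_extend I E a
        have hb := mdifferentiableAt_extend I E b
        have e : (fun y ↦ (h + h') y (extend E a y) (extend E b y)) =
          fun y ↦ h y (extend E a y) (extend E b y) + h' y (extend E a y) (extend E b y) := by
          funext y; simp
        have h1 := tensorDeriv_apply cov hs v ha hb
        have h2 := tensorDeriv_apply cov hh v ha hb
        have h3 := tensorDeriv_apply cov hh' v ha hb
        rw [e, mvfderiv_fun_add (mdifferentiableAt_pairing hh ha hb)
          (mdifferentiableAt_pairing hh' ha hb)] at h1
        simp only [extend_apply_self] at h1 h2 h3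
        change tensorDeriv cov (h + h') x hs v a b =
          tensorDeriv cov h x hh v a b + tensorDeriv cov h' x hh' v a b
        rw [h1, h2, h3]
        simp
        ring
      leibniz := by
        intro h f x hh hf _
        have hs : MDiffAt (fun y ↦ TotalSpace.mk' (E →L[ℝ] E →L[ℝ] ℝ) y ((f • h) y)) x :=
          hf.smul_section hh
        rw [dif_pos hs, dif_pos hh]
        ext v a b
        have ha := mdifferentiableAt_extend I E a
        have hb := mdifferentiableAt_extend I E b
        have e : (fun y ↦ (f • h) y (extend E a y) (extend E b y)) =
          fun y ↦ f y * h y (extend E a y) (extend E b y) := by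
          funext y; simp
        have h1 := tensorDeriv_apply cov hs v ha hb
        have h2 := tensorDeriv_apply cov hh v ha hb
        rw [e, mvfderiv_fun_mul hf (mdifferentiableAt_pairing hh ha hb)] at h1
        simp only [extend_apply_self] at h1 h2
        have e' (c d : TangentSpace I x) : (f • h) x c d = f x * h x c d := rfl
        rw [e', e'] at h1
        change tensorDeriv cov (f • h) x hs v a b =
          f x * tensorDeriv cov h x hh v a b + d% f x v * h x a b
        rw [h1, h2]
        simp only [_root_.add_apply, _root_.smul_apply, smul_eq_mul]
        ring }

lemma tensorConnection_apply
    (hh : MDiffAt (fun y ↦ TotalSpace.mk' (E →L[ℝ] E →L[ℝ] ℝ) y (h y)) x)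
    (v : TangentSpace I x)
    {Y Z : ∀ x : M, TangentSpace I x} (hY : MDiffAt (T% Y) x) (hZ : MDiffAt (T% Z) x) :
    tensorConnection cov h x v (Y x) (Z x) =
      d% (fun y ↦ h y (Y y) (Z y)) x v - h x (cov Y x v) (Z x) - h x (Y x) (cov Z x v) := by
  have e : tensorConnection cov h x = tensorDeriv cov h x hh := dif_pos hh
  rw [e]
  exact tensorDeriv_apply cov hh v hY hZ

/-- The connection is locally metric at `x`: on some open neighbourhood `U` of `x` there is a
smooth metric `g`, parallel with respect to the connection restricted to `U`. -/
def IsLocallyMetricAt (x : M) : Prop :=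
  ∃ (U : Set M) (g : ∀ y : M, BilinearFormAt I y), IsOpen U ∧ x ∈ U ∧
    CMDiff[U] ∞ (fun y ↦ TotalSpace.mk' (E →L[ℝ] E →L[ℝ] ℝ) y (g y)) ∧
    ∀ y ∈ U, g y ∈ symmetricForms I M y ∧ IsPositiveDefinite (g y) ∧ tensorConnection cov g y = 0

end Tensors

end

noncomputable section

/-! ### Total linear differential equations -/

section TotalDifferentialEquation

set_option maxSynthPendingDepth 3

variable {E F : Type*} [NormedAddCommGroup E] [NormedSpace ℝ E]
  [NormedAddCommGroup F] [NormedSpace ℝ F]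

/-! If a smooth local section of $W$ is parallel, curvature annihilates it, and its zero derivative
lies in every fibre. By induction on $i$ its values lie in every $W^{(i)}$, hence in $\widetilde W$
(`mem_terminalSubset_of_parallel`). A parallel metric near $x$ thus puts a positive-definite form
into $\widetilde W_x$.

For the converse, a parallel section is constructed through every element of $\widetilde W_x$. Near
$x$ the set $\widetilde W$ has a smooth frame $X_1,\dots,X_r$. It is flat, being contained in
$V^{(0)}$. It is also parallel (`covariantDerivative_mem_terminalSubset`). The flag becomes
stationary in each fibre, but a priori at an index depending on the point. Since ranks of the
$W^{(i)}$ are lower semicontinuous, the Baire category theorem gives, inside any open set, a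
nonempty open set where $\widetilde W=W^{(i)}$ for one $i$ (`exists_isOpen_derivedFlag_eq_span`).
There $W^{(i+1)}=W^{(i)}$ too, so the second fundamental form vanishes. Hence $\nabla_Y
X_j\in\widetilde W$ on a dense set, and everywhere, because linear independence of
$\nabla_YX_j,X_1,\dots,X_r$ is an open condition.

In the frame and a chart, being parallel becomes a total linear differential equation $df(v)=A(v)f$,
whose integrability condition is the vanishing of the curvature (`connectionForm_flat`). The linear
Frobenius theorem `exists_solution_of_flat` solves it: integrate along rays from the base point,
then show with Grönwall's inequality that the end-point values satisfy the full equation. The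
parallel section through a positive-definite form is symmetric, as $\widetilde W\subseteq W$, and
remains positive definite near $x$. -/

/-- The derivative is $C^1$, hence Lipschitz near $p$; the mean value inequality on the segment from
$q$ to $r$ turns this into a quadratic remainder, uniform in both points. -/
lemma ContDiffAt.exists_taylor_bounds {A : E → F} {p : E} (hA : ContDiffAt ℝ 2 A p) :
    ∃ δ > 0, ∃ C ≥ (1 : ℝ), ∀ q ∈ Metric.ball p δ,
      DifferentiableAt ℝ A q ∧ ‖A q‖ ≤ C ∧ ‖fderiv ℝ A q‖ ≤ C ∧
        ∀ r ∈ Metric.ball p δ, ‖A r - A q - fderiv ℝ A q (r - q)‖ ≤ C * ‖r - q‖ ^ 2 := by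
  have hd : ContDiffAt ℝ 1 (fderiv ℝ A) p := hA.fderiv_right (by norm_num)
  obtain ⟨K, t, ht, hK⟩ := hd.exists_lipschitzOnWith
  have h1 : ∀ᶠ q in 𝓝 p, ‖A q‖ < ‖A p‖ + 1 :=
    hA.continuousAt.norm.eventually_lt_const (by linarith)
  have h2 : ∀ᶠ q in 𝓝 p, ‖fderiv ℝ A q‖ < ‖fderiv ℝ A p‖ + 1 :=
    hd.continuousAt.norm.eventually_lt_const (by linarith)
  have h3 : ∀ᶠ q in 𝓝 p, DifferentiableAt ℝ A q :=
    (hA.eventually (by simp)).mono fun q hq ↦ hq.differentiableAt (by simp)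
  obtain ⟨δ, hδ, hball⟩ := Metric.eventually_nhds_iff_ball.1 (h1.and (h2.and (h3.and ht)))
  set C := ‖A p‖ + ‖fderiv ℝ A p‖ + K + 1
  have hC : ‖A p‖ + 1 ≤ C ∧ ‖fderiv ℝ A p‖ + 1 ≤ C ∧ K ≤ C ∧ 1 ≤ C := by
    have := norm_nonneg (A p); have := norm_nonneg (fderiv ℝ A p); have := K.2
    refine ⟨?_, ?_, ?_, ?_⟩ <;> simp only [C] <;> linarith [K.coe_nonneg]
  refine ⟨δ, hδ, C, hC.2.2.2, fun q hq ↦ ⟨(hball q hq).2.2.1, ?_, ?_, fun r hr ↦ ?_⟩⟩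
  · exact (hball q hq).1.le.trans hC.1
  · exact (hball q hq).2.1.le.trans hC.2.1
  · have hseg : segment ℝ q r ⊆ Metric.ball p δ := (convex_ball p δ).segment_subset hq hr
    have := (convex_segment q r).norm_image_sub_le_of_norm_fderiv_le' (𝕜 := ℝ) (f := A)
      (φ := fderiv ℝ A q) (C := C * ‖r - q‖) (fun z hz ↦ (hball z (hseg hz)).2.2.1) ?_
      (left_mem_segment ℝ q r) (right_mem_segment ℝ q r)
    · rwa [mul_assoc, ← sq] at this
    · intro z hz
      have h4 := hK.dist_le_mul _ (hball z (hseg hz)).2.2.2 _ (hball q hq).2.2.2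
      rw [dist_eq_norm, dist_eq_norm] at h4
      refine h4.trans (mul_le_mul hC.2.2.1 ?_ (norm_nonneg _) (by linarith [hC.2.2.2]))
      simpa [dist_eq_norm] using norm_sub_le_of_mem_segment hz

lemma norm_apply₂_le_of_le (T : E →L[ℝ] F →L[ℝ] F) (u : E) (f : F) {a b c : ℝ}
    (hT : ‖T‖ ≤ a) (hu : ‖u‖ ≤ b) (hf : ‖f‖ ≤ c) : ‖T u f‖ ≤ a * b * c := by
  have ha : 0 ≤ a := (norm_nonneg _).trans hT
  have hb : 0 ≤ b := (norm_nonneg _).trans hu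
  exact (T.le_opNorm₂ u f).trans (by gcongr)

/-- The first-order variation of a solution along a ray, predicted by a flat total differential
equation, solves the equation along the varied ray up to second order. -/
lemma norm_ray_variation_le {B A' : E →L[ℝ] F →L[ℝ] F} {dB : E →L[ℝ] E →L[ℝ] F →L[ℝ] F}
    {x h : E} {φ : F} {t C m : ℝ} (ht : t ∈ Icc (0 : ℝ) 1)
    (hflat : dB x h φ + B h (B x φ) = dB h x φ + B x (B h φ))
    (hB : ‖B‖ ≤ C) (hdB : ‖dB‖ ≤ C) (hρ : ‖A' - B - dB (t • h)‖ ≤ C * ‖h‖ ^ 2)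
    (hxh : ‖x + h‖ ≤ 1) (hh : ‖h‖ ≤ 1) (hφ : ‖φ‖ ≤ m) :
    ‖B x φ + (B h φ + t • (dB x h φ + B h (B x φ))) - A' (x + h) (φ + t • B h φ)‖ ≤
      (C * (m + C * m) + C * m + C * C * m + C * C * m) * ‖h‖ ^ 2 := by
  obtain ⟨ht0, ht1⟩ := ht
  have hC : 0 ≤ C := (norm_nonneg _).trans hB
  have hm : 0 ≤ m := (norm_nonneg _).trans hφ
  set ρ := A' - B - dB (t • h) with hρdef
  have hA' : A' = ρ + B + t • dB h := by rw [hρdef, map_smul]; abel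
  -- Flatness exchanges $x$ and $h$ in the bracket, so all terms of order zero and one in $h$
  -- cancel. Each of the four terms left is quadratic in $h$, the first through the Taylor remainder
  -- $\rho$.
  have e : B x φ + (B h φ + t • (dB x h φ + B h (B x φ))) - A' (x + h) (φ + t • B h φ) =
      -(ρ (x + h) (φ + t • B h φ) + t • dB h h φ + t • B h (B h φ) +
        t • t • dB h (x + h) (B h φ)) := by
    rw [hflat, hA']
    simp only [_root_.add_apply, _root_.smul_apply, map_add, map_smul, smul_add]
    module
  have hts (f : F) {c : ℝ} (hf : ‖f‖ ≤ c) : ‖t • f‖ ≤ c := by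
    rw [norm_smul, Real.norm_of_nonneg ht0]
    exact (mul_le_of_le_one_left (norm_nonneg _) ht1).trans hf
  have hBh : ‖B h φ‖ ≤ C * ‖h‖ * m := norm_apply₂_le_of_le _ _ _ hB le_rfl hφ
  have hBh' : ‖B h φ‖ ≤ C * m := hBh.trans (by
    gcongr; exact mul_le_of_le_one_right hC hh)
  have hdBh : ‖dB h‖ ≤ C * ‖h‖ := (dB.le_opNorm h).trans (by gcongr)
  have h1 : ‖ρ (x + h) (φ + t • B h φ)‖ ≤ C * ‖h‖ ^ 2 * 1 * (m + C * m) :=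
    norm_apply₂_le_of_le _ _ _ hρ hxh ((norm_add_le _ _).trans (add_le_add hφ (hts _ hBh')))
  have h2 : ‖t • dB h h φ‖ ≤ C * ‖h‖ * ‖h‖ * m :=
    hts _ (norm_apply₂_le_of_le _ _ _ hdBh le_rfl hφ)
  have h3 : ‖t • B h (B h φ)‖ ≤ C * ‖h‖ * (C * ‖h‖ * m) :=
    hts _ (norm_apply₂_le_of_le _ _ _ hB le_rfl hBh)
  have h4 : ‖t • t • dB h (x + h) (B h φ)‖ ≤ C * ‖h‖ * 1 * (C * ‖h‖ * m) :=
    hts _ (hts _ (norm_apply₂_le_of_le _ _ _ hdBh hxh hBh))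
  rw [e, norm_neg]
  calc _ ≤ _ := norm_add₄_le
    _ ≤ _ := add_le_add (add_le_add (add_le_add h1 h2) h3) h4
    _ = _ := by ring

/-- A linear differential equation on `[0, 1]` with small coefficients has a solution. -/
lemma exists_hasDerivWithinAt_linear_of_norm_le [CompleteSpace F] {T : ℝ → F →L[ℝ] F}
    (hT : ContinuousOn T (Icc 0 1)) {c : ℝ} (hc : ∀ t ∈ Icc (0 : ℝ) 1, ‖T t‖ ≤ c) (f₀ : F)
    (hcf : c * (‖f₀‖ + 1) ≤ 1) :
    ∃ φ : ℝ → F, φ 0 = f₀ ∧ ∀ t ∈ Icc (0 : ℝ) 1, HasDerivWithinAt φ (T t (φ t)) (Icc 0 1) t := by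
  have hc0 : 0 ≤ c := (norm_nonneg _).trans (hc 0 (by simp))
  -- On the ball of radius $1$ about $f_0$ the speed is at most $c(\|f_0\|+1)\le 1$, so no solution
  -- can leave the ball before time $1$.
  have hP : IsPicardLindelof (fun t f ↦ T t f) (tmin := 0) (tmax := 1) ⟨0, by simp⟩ f₀ 1 0 1
      ⟨c, hc0⟩ := by
    refine ⟨fun t ht ↦ ?_, fun f _ ↦ hT.clm_apply continuousOn_const, fun t ht f hf ↦ ?_, by simp⟩
    · exact ((T t).lipschitz.weaken (by exact_mod_cast hc t ht)).lipschitzOnWith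
    · have : ‖f‖ ≤ ‖f₀‖ + 1 := by
        rw [mem_closedBall_iff_norm] at hf
        have := norm_le_norm_add_norm_sub' f f₀
        have h1 : ‖f - f₀‖ ≤ 1 := by simpa using hf
        linarith
      have h2 := (T t).le_of_opNorm_le_of_le (hc t ht) this
      simpa using h2.trans hcf
  exact hP.exists_eq_forall_mem_Icc_hasDerivWithinAt₀

/-- The values at the end points of the solutions along rays of a flat total differential
equation solve the equation. -/
lemma hasFDerivAt_of_ray_solutions {A : E → E →L[ℝ] F →L[ℝ] F} {p : E} {δ C ε : ℝ} (hC : 1 ≤ C)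
    (hA : ∀ q ∈ Metric.ball p δ, DifferentiableAt ℝ A q ∧ ‖A q‖ ≤ C ∧ ‖fderiv ℝ A q‖ ≤ C ∧
        ∀ r ∈ Metric.ball p δ, ‖A r - A q - fderiv ℝ A q (r - q)‖ ≤ C * ‖r - q‖ ^ 2)
    (hflat : ∀ q ∈ Metric.ball p δ, ∀ u v f, fderiv ℝ A q u v f + A q v (A q u f) =
      fderiv ℝ A q v u f + A q u (A q v f))
    (hεδ : ε ≤ δ) (hε : ε ≤ 1) {φ : E → ℝ → F} {f₀ : F} (hφ0 : ∀ x, ‖x‖ < ε → φ x 0 = f₀)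
    (hφ : ∀ x, ‖x‖ < ε → ∀ t ∈ Icc (0 : ℝ) 1,
      HasDerivWithinAt (φ x) (A (p + t • x) x (φ x t)) (Icc 0 1) t)
    {x : E} (hx : ‖x‖ < ε) :
    HasFDerivAt (fun y ↦ φ y 1) ((A (p + x)).flip (φ x 1)) x := by
  have hcont (y : E) (hy : ‖y‖ < ε) : ContinuousOn (φ y) (Icc 0 1) :=
    fun t ht ↦ (hφ y hy t ht).continuousWithinAt
  have hmem (y : E) (hy : ‖y‖ < ε) (t : ℝ) (ht : t ∈ Icc (0 : ℝ) 1) :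
      p + t • y ∈ Metric.ball p δ := by
    rw [mem_ball_iff_norm, add_sub_cancel_left, norm_smul, Real.norm_of_nonneg ht.1]
    exact (mul_le_of_le_one_left (norm_nonneg _) ht.2).trans_lt (hy.trans_le hεδ)
  obtain ⟨m, hm⟩ := isCompact_Icc.exists_bound_of_continuousOn (hcont x hx)
  set K : ℝ := C * (m + C * m) + C * m + C * C * m + C * C * m
  have key (h : E) (hh : ‖h‖ ≤ 1) (hxh : ‖x + h‖ < ε) :
      ‖φ (x + h) 1 - φ x 1 - A (p + x) h (φ x 1)‖ ≤ K / C * (Real.exp C - 1) * ‖h‖ ^ 2 := by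
    -- The candidate for the solution along the ray of $x+h$: a solution $f$ of the full equation
    -- changes by about $A(p+tx)(th)f$ when its argument moves from $p+tx$ to $p+t(x+h)$.
    set χ : ℝ → F := fun t ↦ φ x t + t • A (p + t • x) h (φ x t) with hχ
    set χ' : ℝ → F := fun t ↦ A (p + t • x) x (φ x t) + (A (p + t • x) h (φ x t) +
      t • (fderiv ℝ A (p + t • x) x h (φ x t) + A (p + t • x) h (A (p + t • x) x (φ x t))))
      with hχ'
    have hder (t : ℝ) (ht : t ∈ Icc (0 : ℝ) 1) : HasDerivWithinAt χ (χ' t) (Icc 0 1) t := by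
      have h1 := hφ x hx t ht
      have hl : HasDerivWithinAt (fun t : ℝ ↦ p + t • x) x (Icc 0 1) t := by
        simpa using ((hasDerivAt_id t).smul_const x).const_add p |>.hasDerivWithinAt
      have h2 : HasDerivWithinAt (fun t : ℝ ↦ A (p + t • x)) (fderiv ℝ A (p + t • x) x)
          (Icc 0 1) t :=
        (hA _ (hmem x hx t ht)).1.hasFDerivAt.comp_hasDerivWithinAt t hl
      have h3 := h2.clm_apply (hasDerivWithinAt_const t (Icc 0 1) h)
      have h4 := h3.clm_apply h1
      have h5 := h1.add ((hasDerivWithinAt_id t _).smul h4)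
      convert! h5 using 1
      simp [hχ']
      abel
    -- Grönwall: $\varphi_{x+h}$ is an exact solution, $\chi$ is one up to $K\|h\|^2$, and both
    -- start at $f_0$.
    have hbound := dist_le_of_approx_trajectories_ODE_of_mem (a := 0) (b := 1) (δ := 0)
      (K := ⟨C, by linarith⟩) (εf := 0) (εg := K * ‖h‖ ^ 2) (s := fun _ ↦ univ)
      (v := fun t f ↦ A (p + t • (x + h)) (x + h) f) (f := φ (x + h)) (g := χ)
      (f' := fun t ↦ A (p + t • (x + h)) (x + h) (φ (x + h) t)) (g' := χ') ?_ (hcont _ hxh) ?_ ?_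
      (fun _ _ ↦ mem_univ _) (fun t ht ↦ (hder t ht).continuousWithinAt) ?_ ?_
      (fun _ _ ↦ mem_univ _) ?_ 1 (by simp)
    · rw [dist_eq_norm, gronwallBound_of_K_ne_0 (by show C ≠ 0; linarith)] at hbound
      change _ ≤ 0 * Real.exp (C * (1 - 0)) + (0 + K * ‖h‖ ^ 2) / C * (Real.exp (C * (1 - 0)) - 1)
        at hbound
      simp only [hχ, one_smul] at hbound
      rw [sub_sub]
      refine hbound.trans (le_of_eq ?_)
      simp
      ring
    · intro t ht
      refine (ContinuousLinearMap.lipschitz _).weaken ?_ |>.lipschitzOnWith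
      have h1 := ((A (p + t • (x + h))).le_opNorm (x + h)).trans
        (mul_le_mul (hA _ (hmem _ hxh t (Ico_subset_Icc_self ht))).2.1 (hxh.le.trans hε)
          (norm_nonneg _) (by linarith))
      rw [mul_one] at h1
      exact_mod_cast h1
    · exact fun t ht ↦ (hφ _ hxh t (Ico_subset_Icc_self ht)).mono_of_mem_nhdsWithin
        (Icc_mem_nhdsGE_of_mem ht)
    · simp
    · exact fun t ht ↦ (hder t (Ico_subset_Icc_self ht)).mono_of_mem_nhdsWithin
        (Icc_mem_nhdsGE_of_mem ht)
    · intro t ht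
      have ht' := Ico_subset_Icc_self ht
      obtain ⟨-, hB, hdB, hT⟩ := hA _ (hmem x hx t ht')
      have hT' := hT _ (hmem _ hxh t ht')
      have e : p + t • (x + h) - (p + t • x) = t • h := by module
      rw [e] at hT'
      rw [dist_eq_norm]
      refine norm_ray_variation_le ht' (hflat _ (hmem x hx t ht') _ _ _) hB hdB
        (hT'.trans ?_) (hxh.le.trans hε) hh (hm t ht')
      rw [norm_smul, Real.norm_of_nonneg ht.1]
      have h1 : t * ‖h‖ ≤ ‖h‖ := mul_le_of_le_one_left (norm_nonneg _) ht.2.le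
      have h0 : 0 ≤ t * ‖h‖ := mul_nonneg ht.1 (norm_nonneg _)
      gcongr
    · simp [hχ, hφ0 x hx, hφ0 _ hxh]
  rw [hasFDerivAt_iff_isLittleO_nhds_zero]
  refine Asymptotics.IsBigO.trans_isLittleO (g := fun h : E ↦ ‖h‖ ^ 2) ?_ ?_
  · refine Asymptotics.IsBigO.of_bound (K / C * (Real.exp C - 1)) ?_
    have h1 : ∀ᶠ h : E in 𝓝 0, ‖h‖ < 1 := by
      simpa using Metric.eventually_nhds_iff_ball.2 ⟨1, one_pos, fun h hh ↦ by simpa using hh⟩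
    have h2 : ∀ᶠ h : E in 𝓝 0, ‖x + h‖ < ε := by
      have : ContinuousAt (fun h : E ↦ ‖x + h‖) 0 := by fun_prop
      exact this.eventually_lt_const (by simpa using hx)
    filter_upwards [h1, h2] with h h1 h2
    simpa using key h h1.le h2
  · simpa using Asymptotics.isLittleO_norm_pow_id one_lt_two

/-- Bootstrapping: the equation expresses the derivative of $f$ through $A$ and $f$, so $C^n$
regularity of $f$ improves to $C^{n+1}$. -/
lemma contDiffOn_infty_of_fderiv_eq_flip {A : E → E →L[ℝ] F →L[ℝ] F} {f : E → F} {U : Set E}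
    (hU : IsOpen U) (hA : ContDiffOn ℝ ∞ A U)
    (hf : ∀ q ∈ U, HasFDerivAt f ((A q).flip (f q)) q) : ContDiffOn ℝ ∞ f U := by
  refine contDiffOn_infty.2 fun n ↦ ?_
  induction n with
  | zero =>
    exact contDiffOn_zero.2 fun q hq ↦ (hf q hq).continuousAt.continuousWithinAt
  | succ n ih =>
    rw [Nat.cast_add, Nat.cast_one, contDiffOn_succ_iff_fderiv_of_isOpen hU]
    refine ⟨fun q hq ↦ (hf q hq).differentiableAt.differentiableWithinAt, by simp, ?_⟩
    have h1 : ContDiffOn ℝ n (fun q ↦ ContinuousLinearMap.flipₗᵢ ℝ E F F (A q)) U :=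
      (ContinuousLinearMap.flipₗᵢ ℝ E F F).contDiff.comp_contDiffOn
        (hA.of_le (WithTop.coe_le_coe.2 le_top))
    refine (h1.clm_apply ih).congr fun q hq ↦ ?_
    rw [(hf q hq).fderiv]
    rfl

/-- **Frobenius' theorem** for total linear differential equations: a flat equation
`df(v) = A(v) f` has a smooth local solution with any given initial value. -/
theorem exists_solution_of_flat [CompleteSpace F] {A : E → E →L[ℝ] F →L[ℝ] F} {U : Set E}
    (hU : IsOpen U) (hA : ContDiffOn ℝ ∞ A U)
    (hflat : ∀ q ∈ U, ∀ u v f, fderiv ℝ A q u v f + A q v (A q u f) =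
      fderiv ℝ A q v u f + A q u (A q v f)) {p : E} (hp : p ∈ U) (f₀ : F) :
    ∃ (U' : Set E) (f : E → F), U' ⊆ U ∧ IsOpen U' ∧ p ∈ U' ∧ ContDiffOn ℝ ∞ f U' ∧ f p = f₀ ∧
      ∀ q ∈ U', HasFDerivAt f ((A q).flip (f q)) q := by
  obtain ⟨δ₁, hδ₁, C, hC, hAC⟩ :=
    ((hA.contDiffAt (hU.mem_nhds hp)).of_le (WithTop.coe_le_coe.2 le_top)).exists_taylor_bounds
      (A := A)
  obtain ⟨δ₂, hδ₂, hδU⟩ := Metric.isOpen_iff.1 hU p hp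
  set δ := min δ₁ δ₂
  have hδ : 0 < δ := lt_min hδ₁ hδ₂
  have hb1 : Metric.ball p δ ⊆ Metric.ball p δ₁ := Metric.ball_subset_ball (min_le_left _ _)
  have hb2 : Metric.ball p δ ⊆ U := (Metric.ball_subset_ball (min_le_right _ _)).trans hδU
  -- The last bound gives the smallness needed to solve the ray equations up to time $1$; the bound
  -- by $1$ enters the Grönwall estimate.
  set ε := min (min δ 1) (1 / (C * (‖f₀‖ + 1)))
  have hCf : 0 < C * (‖f₀‖ + 1) := by positivity
  have hε : 0 < ε := by positivity
  have hεδ : ε ≤ δ := (min_le_left _ _).trans (min_le_left _ _)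
  have hε1 : ε ≤ 1 := (min_le_left _ _).trans (min_le_right _ _)
  have hex (x : E) (hx : ‖x‖ < ε) : ∃ φ : ℝ → F, φ 0 = f₀ ∧ ∀ t ∈ Icc (0 : ℝ) 1,
      HasDerivWithinAt φ (A (p + t • x) x (φ t)) (Icc 0 1) t := by
    have hmem (t : ℝ) (ht : t ∈ Icc (0 : ℝ) 1) : p + t • x ∈ Metric.ball p δ := by
      rw [mem_ball_iff_norm, add_sub_cancel_left, norm_smul, Real.norm_of_nonneg ht.1]
      exact (mul_le_of_le_one_left (norm_nonneg _) ht.2).trans_lt (hx.trans_le hεδ)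
    refine exists_hasDerivWithinAt_linear_of_norm_le (T := fun t ↦ A (p + t • x) x)
      (c := C * ‖x‖) ?_ ?_ f₀ ?_
    · refine ContinuousOn.clm_apply ?_ continuousOn_const
      exact (hA.continuousOn.mono hb2).comp (by fun_prop) hmem
    · intro t ht
      exact (A _).le_of_opNorm_le (hAC _ (hb1 (hmem t ht))).2.1 _
    · have : ‖x‖ ≤ 1 / (C * (‖f₀‖ + 1)) := hx.le.trans (min_le_right _ _)
      rw [le_div_iff₀ hCf] at this
      linarith
  choose! φ hφ0 hφ using hex
  have hmain (x : E) (hx : ‖x‖ < ε) :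
      HasFDerivAt (fun y ↦ φ y 1) ((A (p + x)).flip (φ x 1)) x :=
    hasFDerivAt_of_ray_solutions hC
      (fun q hq ↦ ⟨(hAC q (hb1 hq)).1, (hAC q (hb1 hq)).2.1, (hAC q (hb1 hq)).2.2.1,
        fun r hr ↦ (hAC q (hb1 hq)).2.2.2 r (hb1 hr)⟩)
      (fun q hq ↦ hflat q (hb2 hq)) hεδ hε1 hφ0 hφ hx
  have hsol (q : E) (hq : q ∈ Metric.ball p ε) :
      HasFDerivAt (fun q ↦ φ (q - p) 1) ((A q).flip (φ (q - p) 1)) q := by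
    have h := hmain (q - p) (by rwa [← mem_ball_iff_norm])
    rw [add_sub_cancel] at h
    exact h.comp q ((hasFDerivAt_id q).sub_const p)
  have hsub : Metric.ball p ε ⊆ U := (Metric.ball_subset_ball hεδ).trans hb2
  refine ⟨Metric.ball p ε, fun q ↦ φ (q - p) 1, hsub, Metric.isOpen_ball,
    Metric.mem_ball_self hε, contDiffOn_infty_of_fderiv_eq_flip Metric.isOpen_ball
      (hA.mono hsub) hsol, ?_, hsol⟩
  have h0 : ‖(0 : E)‖ < ε := by simpa using hε
  -- The ray of direction $0$ has zero velocity, so its solution stays at $f_0$; this is the initial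
  -- condition.
  have hconst := (convex_Icc (0 : ℝ) 1).norm_image_sub_le_of_norm_hasDerivWithin_le (C := 0)
    (fun t ht ↦ hφ 0 h0 t ht) (fun t ht ↦ by simp) (left_mem_Icc.2 zero_le_one)
    (right_mem_Icc.2 zero_le_one)
  simp only [zero_mul, norm_le_zero_iff, sub_eq_zero] at hconst
  simp [hconst, hφ0 0 h0]

end TotalDifferentialEquation

/-! ### Vector fields acting on functions, and coordinate vector fields -/

section VectorFields

set_option maxSynthPendingDepth 3

variable {E : Type*} [NormedAddCommGroup E] [NormedSpace ℝ E]
  {H : Type*} [TopologicalSpace H] {I : ModelWithCorners ℝ E H}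
  {M : Type*} [TopologicalSpace M] [ChartedSpace H M]

variable (I) in
/-- The coordinate vector field of the preferred chart at `x₀` in the direction `v`. -/
def coordVectorField (x₀ : M) (v : E) : ∀ y : M, TangentSpace I y :=
  VectorField.mpullback I 𝓘(ℝ, E) (extChartAt I x₀) (fun _ ↦ v)

lemma coordVectorField_apply (x₀ : M) (v : E) (y : M) :
    coordVectorField I x₀ v y = (mfderiv I 𝓘(ℝ, E) (extChartAt I x₀) y).inverse v := rfl

variable [IsManifold I ∞ M]

lemma ContMDiffAt.mvfderiv_apply {f : M → ℝ} {Y : ∀ y : M, TangentSpace I y} {x : M}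
    {m n : ℕ∞ω} (hf : CMDiffAt n f x) (hY : CMDiffAt m (T% Y) x) (hmn : m + 1 ≤ n) :
    CMDiffAt m (fun y ↦ d% f y (Y y)) x := by
  have h := (hf.mfderiv_const hmn).clm_apply_of_inCoordinates (b₁ := id) (b₂ := f) hY
    (hf.of_le (le_self_add.trans hmn))
  exact (contMDiff_snd_tangentBundle_modelSpace ℝ 𝓘(ℝ, ℝ)).contMDiffAt.comp x h

lemma ContMDiffOn.mvfderiv_apply {f : M → ℝ} {Y : ∀ y : M, TangentSpace I y} {U : Set M}
    (hU : IsOpen U) (hf : CMDiff[U] ∞ f) (hY : CMDiff[U] ∞ (T% Y)) :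
    CMDiff[U] ∞ (fun y ↦ d% f y (Y y)) := fun _ hy ↦
  ((hf.contMDiffAt (hU.mem_nhds hy)).mvfderiv_apply (hY.contMDiffAt (hU.mem_nhds hy))
    le_rfl).contMDiffWithinAt

/-- The Lie bracket of vector fields is the commutator of the corresponding derivations. -/
lemma mvfderiv_mlieBracket_apply [CompleteSpace E] {f : M → ℝ} {X Y : ∀ y : M, TangentSpace I y}
    {x : M} (hf : CMDiffAt ∞ f x) (hX : CMDiffAt ∞ (T% X) x) (hY : CMDiffAt ∞ (T% Y) x) :
    d% f x (VectorField.mlieBracket I X Y x) =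
      d% (fun y ↦ d% f y (Y y)) x (X x) - d% (fun y ↦ d% f y (X y)) x (Y x) := by
  by_cases hw : ∃ w : TangentSpace I x, w ≠ 0
  swap
  · push Not at hw
    rw [hw (VectorField.mlieBracket I X Y x), hw (X x), hw (Y x)]
    simp
  obtain ⟨w, hw⟩ := hw
  have h2 : minSmoothness ℝ 2 = 2 := by simp
  have : IsManifold I (minSmoothness ℝ 3) M := by
    simp only [minSmoothness_of_isRCLikeNormedField]; infer_instance
  have : IsManifold I (minSmoothness ℝ 2) M := by
    simp only [minSmoothness_of_isRCLikeNormedField]; infer_instance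
  have le2 : (2 : ℕ∞ω) ≤ ∞ := WithTop.coe_le_coe.2 le_top
  have le1 : (1 : ℕ∞ω) ≤ ∞ := WithTop.coe_le_coe.2 le_top
  -- An auxiliary field with a nonzero value $w$ at $x$. Subtracting $f$ times the Jacobi identity
  -- for $X,Y,W$ from the one for $X,Y,fW$ leaves the claimed identity times $w$: the first-order
  -- terms in $f$ are symmetric in $X,Y$ and cancel.
  set W : ∀ y : M, TangentSpace I y := extend E w
  have hW : CMDiffAt ∞ (T% W) x := contMDiffAt_extend I E w
  have hWx : W x = w := extend_apply_self ..
  have hfev : ∀ᶠ y in 𝓝 x, MDiffAt f y :=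
    ((contMDiffAt_iff_contMDiffAt_nhds (by simp)).1 (hf.of_le le1)).mono
      fun _ hy ↦ hy.mdifferentiableAt one_ne_zero
  have hWev : ∀ᶠ y in 𝓝 x, MDiffAt (T% W) y :=
    ((contMDiffAt_iff_contMDiffAt_nhds (by simp)).1 (hW.of_le le1)).mono
      fun _ hy ↦ hy.mdifferentiableAt one_ne_zero
  have hbr {Z : ∀ y : M, TangentSpace I y} (hZ : CMDiffAt ∞ (T% Z) x) :
      MDiffAt (T% (VectorField.mlieBracket I Z W)) x := by
    have : IsManifold I ((2 : ℕ∞) + 1) M := IsManifold.of_le (n := ∞) (WithTop.coe_le_coe.2 le_top)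
    exact (ContMDiffAt.mlieBracket_vectorField (n := 2) (m := 1) (hZ.of_le le2) (hW.of_le le2)
      (by simp; norm_num)).mdifferentiableAt one_ne_zero
  have hdf {Z : ∀ y : M, TangentSpace I y} (hZ : CMDiffAt ∞ (T% Z) x) :
      MDiffAt (fun y ↦ d% f y (Z y)) x :=
    (hf.mvfderiv_apply hZ le_rfl).mdifferentiableAt (by simp)
  have hfx : MDiffAt f x := hfev.self_of_nhds
  have hWd : MDiffAt (T% W) x := hWev.self_of_nhds
  have expand {Z Z' : ∀ y : M, TangentSpace I y} (hZ : CMDiffAt ∞ (T% Z) x) :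
      VectorField.mlieBracket I Z' (VectorField.mlieBracket I Z (f • W)) x =
        d% (fun y ↦ d% f y (Z y)) x (Z' x) • W x + d% f x (Z x) • VectorField.mlieBracket I Z' W x
        + (d% f x (Z' x) • VectorField.mlieBracket I Z W x
          + f x • VectorField.mlieBracket I Z' (VectorField.mlieBracket I Z W) x) := by
    have e : VectorField.mlieBracket I Z (f • W) =ᶠ[𝓝 x]
        ((fun y ↦ d% f y (Z y)) • W + f • VectorField.mlieBracket I Z W :
          ∀ y : M, TangentSpace I y) := by
      filter_upwards [hfev, hWev] with _ hy hy'
      exact VectorField.mlieBracket_smul_right hy hy'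
    rw [(Filter.EventuallyEq.refl _ Z').mlieBracket_vectorField_eq e,
      VectorField.mlieBracket_add_right ((hdf hZ).smul_section hWd) (hfx.smul_section (hbr hZ)),
      VectorField.mlieBracket_smul_right (hdf hZ) hWd,
      VectorField.mlieBracket_smul_right hfx (hbr hZ)]
  have hfW : CMDiffAt ∞ (T% (f • W)) x := hf.smul_section hW
  have J1 := VectorField.leibniz_identity_mlieBracket_apply (hX.of_le (h2.trans_le le2))
    (hY.of_le (h2.trans_le le2)) (hfW.of_le (h2.trans_le le2))
  have J2 := VectorField.leibniz_identity_mlieBracket_apply (hX.of_le (h2.trans_le le2))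
    (hY.of_le (h2.trans_le le2)) (hW.of_le (h2.trans_le le2))
  rw [expand hY, expand hX, VectorField.mlieBracket_smul_right hfx hWd, J2, hWx] at J1
  have key : (d% f x (VectorField.mlieBracket I X Y x) -
      (d% (fun y ↦ d% f y (Y y)) x (X x) - d% (fun y ↦ d% f y (X y)) x (Y x))) • w = 0 := by
    rw [sub_smul, sub_smul, sub_eq_zero]
    rw [← sub_eq_zero] at J1 ⊢
    rw [← neg_eq_zero, ← J1]
    module
  exact sub_eq_zero.1 ((smul_eq_zero.1 key).resolve_right hw)

lemma exists_coordVectorField_eq {x₀ y : M} (hy : y ∈ (extChartAt I x₀).source)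
    (w : TangentSpace I y) : ∃ v : E, coordVectorField I x₀ v y = w :=
  ⟨mfderiv I 𝓘(ℝ, E) (extChartAt I x₀) y w,
    (isInvertible_mfderiv_extChartAt hy).inverse_apply_self w⟩

lemma contMDiffOn_coordVectorField [CompleteSpace E] (x₀ : M) (v : E) :
    CMDiff[(extChartAt I x₀).source] ∞ (T% (coordVectorField I x₀ v)) := by
  intro y hy
  refine (ContMDiffAt.mpullback_vectorField_preimage (n := ∞) ?_ (contMDiffAt_extChartAt' ?_)
    (isInvertible_mfderiv_extChartAt hy) le_rfl).contMDiffWithinAt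
  · exact contMDiffAt_vectorSpace_iff_contDiffAt.2 contDiffAt_const
  · rwa [extChartAt_source] at hy

/-- Pullback along the chart commutes with brackets, and constant fields commute. -/
lemma mlieBracket_coordVectorField [CompleteSpace E] {x₀ y : M}
    (hy : y ∈ (extChartAt I x₀).source) (u v : E) :
    VectorField.mlieBracket I (coordVectorField I x₀ u) (coordVectorField I x₀ v) y = 0 := by
  have : IsManifold I (minSmoothness ℝ 3) M := by
    simp only [minSmoothness_of_isRCLikeNormedField]; infer_instance
  have hc (v : E) : MDifferentiableAt 𝓘(ℝ, E) 𝓘(ℝ, E).tangent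
      (fun z ↦ (⟨z, v⟩ : TangentBundle 𝓘(ℝ, E) E)) (extChartAt I x₀ y) := by
    have h : ContMDiffAt 𝓘(ℝ, E) 𝓘(ℝ, E).tangent 1
        (fun z ↦ (⟨z, v⟩ : TangentBundle 𝓘(ℝ, E) E)) (extChartAt I x₀ y) :=
      contMDiffAt_vectorSpace_iff_contDiffAt.2 contDiffAt_const
    exact h.mdifferentiableAt one_ne_zero
  have h := VectorField.mpullback_mlieBracket (I := I) (hc u) (hc v)
    (contMDiffAt_extChartAt' (n := ∞) (by rwa [extChartAt_source] at hy))
    (by simpa using WithTop.coe_le_coe.2 (le_top : (2 : ℕ∞) ≤ ⊤))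
  refine h.symm.trans ?_
  have h0 : VectorField.mlieBracket 𝓘(ℝ, E) (fun _ : E ↦ u) (fun _ : E ↦ v)
      (extChartAt I x₀ y) = 0 := by
    have h := congrFun (VectorField.mlieBracketWithin_eq_lieBracketWithin (𝕜 := ℝ)
      (V := fun _ : E ↦ u) (W := fun _ : E ↦ v) (s := univ)) (extChartAt I x₀ y)
    refine h.trans ?_
    simp [VectorField.lieBracket]
    rfl
  rw [VectorField.mpullback_apply]
  exact (congrArg _ h0).trans (map_zero _)

lemma mvfderiv_comp_extChartAt_coordVectorField {x₀ y : M}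
    (hy : y ∈ (extChartAt I x₀).source) {g : E → ℝ}
    (hg : DifferentiableAt ℝ g (extChartAt I x₀ y)) (v : E) :
    d% (fun z : M ↦ g (extChartAt I x₀ z)) y (coordVectorField I x₀ v y) =
      fderiv ℝ g (extChartAt I x₀ y) v := by
  have h1 := mvfderiv_comp_apply (I := 𝓘(ℝ, E)) (I' := I) (f := extChartAt I x₀) y
    hg.mdifferentiableAt
    (mdifferentiableAt_extChartAt (by rwa [extChartAt_source] at hy))
    (coordVectorField I x₀ v y)
  refine h1.trans ?_
  have h2 : mfderiv I 𝓘(ℝ, E) (extChartAt I x₀) y (coordVectorField I x₀ v y) = v :=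
    (isInvertible_mfderiv_extChartAt hy).self_apply_inverse v
  rw [h2]
  simp only [mvfderiv, mfderiv_eq_fderiv]
  rfl

end VectorFields

/-! ### Families of smooth sections of a vector bundle -/

section Sections

set_option maxSynthPendingDepth 3

variable {E : Type*} [NormedAddCommGroup E] [NormedSpace ℝ E]
  {H : Type*} [TopologicalSpace H] {I : ModelWithCorners ℝ E H}
  {M : Type*} [TopologicalSpace M]
  {F : Type*} [NormedAddCommGroup F] [NormedSpace ℝ F]
  {V : M → Type*} [TopologicalSpace (TotalSpace F V)]
  [∀ x, AddCommGroup (V x)] [∀ x, Module ℝ (V x)] [∀ x, TopologicalSpace (V x)]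
  [FiberBundle F V] [VectorBundle ℝ F V]

lemma LinearIndependent.trivialization {ι : Type*} {σ : ι → ∀ y : M, V y} {y z : M}
    (hz : z ∈ (trivializationAt F V y).baseSet) :
    LinearIndependent ℝ (fun i ↦ (trivializationAt F V y ⟨z, σ i z⟩).2) ↔
      LinearIndependent ℝ (fun i ↦ σ i z) := by
  set e := trivializationAt F V y
  rw [← LinearMap.linearIndependent_iff (e.linearEquivAt ℝ z hz).toLinearMap (LinearEquiv.ker _)]
  rfl

variable [ChartedSpace H M]

lemma eventually_linearIndependent_sections {ι : Type*} [Finite ι] {σ : ι → ∀ y : M, V y} {y : M}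
    (hσ : ∀ i, CMDiffAt ∞ (T% (σ i)) y) (hli : LinearIndependent ℝ (fun i ↦ σ i y)) :
    ∀ᶠ z in 𝓝 y, LinearIndependent ℝ (fun i ↦ σ i z) := by
  have hy := mem_baseSet_trivializationAt F V y
  rw [← LinearIndependent.trivialization (F := F) hy] at hli
  have hc : ContinuousAt (fun z i ↦ (trivializationAt F V y ⟨z, σ i z⟩).2) y :=
    continuousAt_pi.2 fun i ↦ ((contMDiffAt_section y).1 (hσ i)).continuousAt
  filter_upwards [hc.eventually hli.eventually,
    (trivializationAt F V y).open_baseSet.mem_nhds hy] with z hz hzb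
  exact (LinearIndependent.trivialization hzb).1 hz

/-- The coefficients of a smooth section with respect to smooth, pointwise linearly independent
sections are smooth. -/
lemma exists_contMDiffOn_coeff [FiniteDimensional ℝ F] {ι : Type*} [Fintype ι]
    {σ : ι → ∀ y : M, V y} {τ : ∀ y : M, V y} {U : Set M} (hU : IsOpen U)
    (hσ : ∀ i, CMDiff[U] ∞ (T% (σ i))) (hli : ∀ z ∈ U, LinearIndependent ℝ (fun i ↦ σ i z))
    (hτ : CMDiff[U] ∞ (T% τ)) (hspan : ∀ z ∈ U, τ z ∈ Submodule.span ℝ (range fun i ↦ σ i z)) :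
    ∃ a : ι → M → ℝ, (∀ i, CMDiff[U] ∞ (a i)) ∧ ∀ z ∈ U, τ z = ∑ i, a i z • σ i z := by
  have hex (z : M) (hz : z ∈ U) : ∃ c : ι → ℝ, ∑ i, c i • σ i z = τ z :=
    (Submodule.mem_span_range_iff_exists_fun ℝ).1 (hspan z hz)
  choose! a ha using hex
  refine ⟨fun i z ↦ a z i, ?_, fun z hz ↦ (ha z hz).symm⟩
  suffices h : ContMDiffOn I 𝓘(ℝ, ι → ℝ) ∞ a U from fun i ↦ (contMDiffOn_pi_space.1 h) i
  intro y hy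
  refine ContMDiffAt.contMDiffWithinAt ?_
  set e := trivializationAt F V y
  have hyb : y ∈ e.baseSet := mem_baseSet_trivializationAt F V y
  have hUy := hU.mem_nhds hy
  -- `S z` maps coefficients to the section they define, read in a trivialization. If `L` is a left
  -- inverse of `S y`, then `L ∘L S z` is invertible for `z` near `y`, and the coefficients are `(L
  -- ∘L S z).inverse (L (e ⟨z, τ z⟩).2)`, which is smooth in `z`.
  let S : M → (ι → ℝ) →L[ℝ] F := fun z ↦
    ∑ i, (ContinuousLinearMap.proj (R := ℝ) (φ := fun _ : ι ↦ ℝ) i).smulRight (e ⟨z, σ i z⟩).2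
  have hS (z : M) (c : ι → ℝ) : S z c = ∑ i, c i • (e ⟨z, σ i z⟩).2 := by
    simp [S]
  have hSsmooth : CMDiffAt ∞ S y := by
    refine contMDiffAt_finsetSum fun i _ ↦ ?_
    exact ContDiff.comp_contMDiffAt
      (ContinuousLinearMap.smulRightL ℝ (ι → ℝ) F (ContinuousLinearMap.proj i)).contDiff
      ((contMDiffAt_section y).1 ((hσ i).contMDiffAt hUy))
  have hinj : Function.Injective (S y) := by
    rw [injective_iff_map_eq_zero]
    intro c hc
    have h := (LinearIndependent.trivialization (F := F) hyb).2 (hli y hy)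
    funext i
    exact Fintype.linearIndependent_iff.1 h c (by rw [← hS]; exact hc) i
  obtain ⟨L₀, hL₀⟩ := LinearMap.exists_leftInverse_of_injective (S y).toLinearMap
    (LinearMap.ker_eq_bot.2 hinj)
  let L : F →L[ℝ] (ι → ℝ) := LinearMap.toContinuousLinearMap L₀
  have hLS : L ∘L S y = ContinuousLinearEquiv.refl ℝ (ι → ℝ) := by
    ext1 c
    exact congrArg (fun T : (ι → ℝ) →ₗ[ℝ] (ι → ℝ) ↦ T c) hL₀
  have hG : CMDiffAt ∞ (fun z ↦ L ∘L S z) y :=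
    ContDiff.comp_contMDiffAt (ContinuousLinearMap.compL ℝ (ι → ℝ) F (ι → ℝ) L).contDiff hSsmooth
  have hinv : ContDiffAt ℝ ∞ ContinuousLinearMap.inverse (L ∘L S y) := by
    rw [hLS]; exact contDiffAt_map_inverse _
  have hGinv : CMDiffAt ∞ (fun z ↦ (L ∘L S z).inverse) y :=
    hinv.contMDiffAt.comp y hG
  have hτ' : ContMDiffAt I 𝓘(ℝ, ι → ℝ) ∞ (fun z ↦ L (e ⟨z, τ z⟩).2) y :=
    ContDiff.comp_contMDiffAt L.contDiff ((contMDiffAt_section y).1 (hτ.contMDiffAt hUy))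
  refine (hGinv.clm_apply hτ').congr_of_eventuallyEq ?_
  have hunit : ∀ᶠ z in 𝓝 y, L ∘L S z ∈ range ((↑) : ((ι → ℝ) ≃L[ℝ] (ι → ℝ)) → _) :=
    hG.continuousAt.eventually (by
      change _ ∈ 𝓝 (L ∘L S y)
      rw [hLS]; exact ContinuousLinearEquiv.nhds _)
  filter_upwards [hunit, e.open_baseSet.mem_nhds hyb, hUy] with z ⟨Q, hQ⟩ hzb hzU
  have h1 : (e ⟨z, τ z⟩).2 = S z (a z) := by
    rw [hS, ← ha z hzU]
    have hlin := map_sum (e.linearEquivAt ℝ z hzb) (fun i ↦ a z i • σ i z) Finset.univ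
    simp only [map_smul] at hlin
    exact hlin
  have h2 : L (S z (a z)) = Q (a z) := by
    rw [← ContinuousLinearEquiv.coe_coe, hQ]; rfl
  rw [h1, h2, ← hQ, ContinuousLinearMap.inverse_equiv]
  simp

end Sections

/-! ### Smooth connections and their curvature -/

section Curvature

set_option maxSynthPendingDepth 3

variable {E : Type*} [NormedAddCommGroup E] [NormedSpace ℝ E]
  {H : Type*} [TopologicalSpace H] {I : ModelWithCorners ℝ E H}
  {M : Type*} [TopologicalSpace M] [ChartedSpace H M]
  {F : Type*} [NormedAddCommGroup F] [NormedSpace ℝ F]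
  {V : M → Type*} [TopologicalSpace (TotalSpace F V)]
  [∀ x, AddCommGroup (V x)] [∀ x, Module ℝ (V x)] [∀ x, TopologicalSpace (V x)]
  [FiberBundle F V]

lemma ContMDiffOn.mdifferentiableAt_section {U : Set M} (hU : IsOpen U) {σ : ∀ y : M, V y}
    (hσ : CMDiff[U] ∞ (T% σ)) {x : M} (hx : x ∈ U) : MDiffAt (T% σ) x :=
  (hσ.contMDiffAt (hU.mem_nhds hx)).mdifferentiableAt (by simp)

lemma ContMDiffOn.mdifferentiableAt_of_isOpen {U : Set M} (hU : IsOpen U) {f : M → ℝ}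
    (hf : CMDiff[U] ∞ f) {x : M} (hx : x ∈ U) : MDiffAt f x :=
  (hf.contMDiffAt (hU.mem_nhds hx)).mdifferentiableAt (by simp)

variable [∀ x, IsTopologicalAddGroup (V x)] [∀ x, ContinuousSMul ℝ (V x)]

namespace CovariantDerivative

variable (cov : CovariantDerivative I F V)

lemma congr_of_eqOn {U : Set M} (hU : IsOpen U) {σ τ : ∀ y : M, V y} {x : M} (hx : x ∈ U)
    (hτ : MDiffAt (T% τ) x) (h : ∀ y ∈ U, σ y = τ y) : cov σ x = cov τ x := by
  have hσ : MDiffAt (T% σ) x := hτ.congr_of_eventuallyEq <| by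
    filter_upwards [hU.mem_nhds hx] with y hy
    rw [h y hy]
  exact cov.isCovariantDerivativeOn.congr_of_eqOn hσ hτ (hU.mem_nhds hx) h

lemma leibniz_apply {σ : ∀ y : M, V y} {f : M → ℝ} {x : M} (hσ : MDiffAt (T% σ) x)
    (hf : MDiffAt f x) (v : TangentSpace I x) :
    cov (f • σ) x v = f x • cov σ x v + d% f x v • σ x := by
  rw [cov.isCovariantDerivativeOnUniv.leibniz hσ hf]
  rfl

variable [VectorBundle ℝ F V]

lemma sub_apply {σ τ : ∀ y : M, V y} {x : M} (hσ : MDiffAt (T% σ) x) (hτ : MDiffAt (T% τ) x) :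
    cov (σ - τ) x = cov σ x - cov τ x := by
  have h := cov.isCovariantDerivativeOnUniv.add (mdifferentiableAt_sub_section hσ hτ) hτ
  rw [sub_add_cancel] at h
  rw [h, add_sub_cancel_right]

lemma sum_smul_apply {ι : Type*} (s : Finset ι) {a : ι → M → ℝ} {σ : ι → ∀ y : M, V y} {x : M}
    (ha : ∀ i, MDiffAt (a i) x) (hσ : ∀ i, MDiffAt (T% (σ i)) x) (v : TangentSpace I x) :
    cov (∑ i ∈ s, a i • σ i) x v = ∑ i ∈ s, (a i x • cov (σ i) x v + d% (a i) x v • σ i x) := by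
  classical
  -- Additivity of `cov` needs differentiable sections, so the induction carries differentiability
  -- of the partial sums.
  suffices h : MDiffAt (T% (∑ i ∈ s, a i • σ i)) x ∧ cov (∑ i ∈ s, a i • σ i) x v =
      ∑ i ∈ s, (a i x • cov (σ i) x v + d% (a i) x v • σ i x) from h.2
  induction s using Finset.induction_on with
  | empty =>
    simp only [Finset.sum_empty]
    exact ⟨mdifferentiableAt_zeroSection .., by simp⟩
  | insert i s hi ih =>
    have h1 : MDiffAt (T% (a i • σ i)) x := (ha i).smul_section (hσ i)
    rw [Finset.sum_insert hi, Finset.sum_insert hi]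
    refine ⟨mdifferentiableAt_add_section h1 ih.1, ?_⟩
    rw [cov.isCovariantDerivativeOnUniv.add h1 ih.1,
      cov.isCovariantDerivativeOnUniv.leibniz (hσ i) (ha i), ← ih.2]
    rfl

end CovariantDerivative

variable [IsManifold I ∞ M]

/-- A connection is smooth if it maps smooth local sections, differentiated along smooth local
vector fields, to smooth local sections. -/
def IsSmoothConnection (cov : CovariantDerivative I F V) : Prop :=
  ∀ (U : Set M) (σ : ∀ y : M, V y) (Y : ∀ y : M, TangentSpace I y), IsOpen U →
    CMDiff[U] ∞ (T% σ) → CMDiff[U] ∞ (T% Y) → CMDiff[U] ∞ (T% (fun y ↦ cov σ y (Y y)))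

variable {cov : CovariantDerivative I F V} {U : Set M} {X Y : ∀ y : M, TangentSpace I y}
  {σ τ : ∀ y : M, V y} {x : M}

lemma curvatureAt_congr (hcov : IsSmoothConnection cov) (hU : IsOpen U)
    (hX : CMDiff[U] ∞ (T% X)) (hY : CMDiff[U] ∞ (T% Y)) (hτ : CMDiff[U] ∞ (T% τ))
    (h : ∀ y ∈ U, σ y = τ y) (hx : x ∈ U) :
    curvatureAt cov X Y σ x = curvatureAt cov X Y τ x := by
  have e (y) (hy : y ∈ U) : cov σ y = cov τ y :=
    cov.congr_of_eqOn hU hy (hτ.mdifferentiableAt_section hU hy) h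
  have second {Z : ∀ y : M, TangentSpace I y} (hZ : CMDiff[U] ∞ (T% Z)) :
      cov (fun y ↦ cov σ y (Z y)) x = cov (fun y ↦ cov τ y (Z y)) x :=
    cov.congr_of_eqOn hU hx ((hcov U τ Z hU hτ hZ).mdifferentiableAt_section hU hx)
      (fun y hy ↦ by rw [e y hy])
  rw [curvatureAt, curvatureAt, e x hx, second hX, second hY]

variable [VectorBundle ℝ F V]

lemma curvatureAt_add (hcov : IsSmoothConnection cov) (hU : IsOpen U)
    (hX : CMDiff[U] ∞ (T% X)) (hY : CMDiff[U] ∞ (T% Y)) (hσ : CMDiff[U] ∞ (T% σ))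
    (hτ : CMDiff[U] ∞ (T% τ)) (hx : x ∈ U) :
    curvatureAt cov X Y (σ + τ) x = curvatureAt cov X Y σ x + curvatureAt cov X Y τ x := by
  have second {Z : ∀ y : M, TangentSpace I y} (hZ : CMDiff[U] ∞ (T% Z)) :
      cov (fun y ↦ cov (σ + τ) y (Z y)) x =
        cov (fun y ↦ cov σ y (Z y)) x + cov (fun y ↦ cov τ y (Z y)) x := by
    have h1 := (hcov U σ Z hU hσ hZ).mdifferentiableAt_section hU hx
    have h2 := (hcov U τ Z hU hτ hZ).mdifferentiableAt_section hU hx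
    rw [← cov.isCovariantDerivativeOnUniv.add h1 h2]
    refine cov.congr_of_eqOn hU hx (mdifferentiableAt_add_section h1 h2) fun y hy ↦ ?_
    rw [cov.isCovariantDerivativeOnUniv.add (hσ.mdifferentiableAt_section hU hy)
      (hτ.mdifferentiableAt_section hU hy)]
    rfl
  rw [curvatureAt, curvatureAt, curvatureAt, second hX, second hY,
    cov.isCovariantDerivativeOnUniv.add (hσ.mdifferentiableAt_section hU hx)
      (hτ.mdifferentiableAt_section hU hx)]
  simp only [_root_.add_apply]
  abel

variable [CompleteSpace E]

/-- The mixed first-order terms cancel by antisymmetry, and the second derivatives of $f$ cancel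
against $\nabla_{[X,Y]}$ because the bracket acts as a commutator. -/
lemma curvatureAt_smul (hcov : IsSmoothConnection cov) (hU : IsOpen U)
    (hX : CMDiff[U] ∞ (T% X)) (hY : CMDiff[U] ∞ (T% Y)) (hσ : CMDiff[U] ∞ (T% σ))
    {f : M → ℝ} (hf : CMDiff[U] ∞ f) (hx : x ∈ U) :
    curvatureAt cov X Y (f • σ) x = f x • curvatureAt cov X Y σ x := by
  have second {Z : ∀ y : M, TangentSpace I y} (hZ : CMDiff[U] ∞ (T% Z)) (v : TangentSpace I x) :
      cov (fun y ↦ cov (f • σ) y (Z y)) x v =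
        f x • cov (fun y ↦ cov σ y (Z y)) x v + d% f x v • cov σ x (Z x)
          + (d% f x (Z x) • cov σ x v + d% (fun y ↦ d% f y (Z y)) x v • σ x) := by
    have h1 := (hcov U σ Z hU hσ hZ).mdifferentiableAt_section hU hx
    have h2 := hσ.mdifferentiableAt_section hU hx
    have h3 := (hf.mvfderiv_apply hU hZ).mdifferentiableAt_of_isOpen hU hx
    have h4 := hf.mdifferentiableAt_of_isOpen hU hx
    have e : cov (fun y ↦ cov (f • σ) y (Z y)) x =
        cov (f • (fun y ↦ cov σ y (Z y)) + (fun y ↦ d% f y (Z y)) • σ) x := by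
      refine cov.congr_of_eqOn hU hx
        (mdifferentiableAt_add_section (h4.smul_section h1) (h3.smul_section h2)) fun y hy ↦ ?_
      exact cov.leibniz_apply (hσ.mdifferentiableAt_section hU hy)
        (hf.mdifferentiableAt_of_isOpen hU hy) _
    rw [e, cov.isCovariantDerivativeOnUniv.add (h4.smul_section h1) (h3.smul_section h2),
      _root_.add_apply, cov.leibniz_apply h1 h4, cov.leibniz_apply h2 h3]
  have hxU := hU.mem_nhds hx
  rw [curvatureAt, curvatureAt, second hX, second hY,
    cov.leibniz_apply (hσ.mdifferentiableAt_section hU hx) (hf.mdifferentiableAt_of_isOpen hU hx),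
    mvfderiv_mlieBracket_apply (hf.contMDiffAt hxU) (hX.contMDiffAt hxU) (hY.contMDiffAt hxU)]
  module

variable [FiniteDimensional ℝ F] [ContMDiffVectorBundle ∞ F V I]

/-- The curvature is a tensor: `R(X, Y)σ` vanishes where `σ` does. -/
lemma curvatureAt_eq_zero_of_apply_eq_zero (hcov : IsSmoothConnection cov) (hU : IsOpen U)
    (hX : CMDiff[U] ∞ (T% X)) (hY : CMDiff[U] ∞ (T% Y)) (hσ : CMDiff[U] ∞ (T% σ)) (hx : x ∈ U)
    (h0 : σ x = 0) : curvatureAt cov X Y σ x = 0 := by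
  classical
  have : ContMDiffVectorBundle 1 F V I := ContMDiffVectorBundle.of_le (WithTop.coe_le_coe.2 le_top)
  set e := trivializationAt F V x
  set b := Module.finBasis ℝ F
  set U' := U ∩ e.baseSet
  have hU' : IsOpen U' := hU.inter e.open_baseSet
  have hx' : x ∈ U' := ⟨hx, mem_baseSet_trivializationAt F V x⟩
  set s := e.localFrame b
  set a : Fin (Module.finrank ℝ F) → M → ℝ := fun i y ↦ e.localFrameCoeff I b i y (σ y)
  have hX' := hX.mono (inter_subset_left : U' ⊆ U)
  have hY' := hY.mono (inter_subset_left : U' ⊆ U)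
  have hs (i) : CMDiff[U'] ∞ (T% (s i)) :=
    (e.contMDiffOn_localFrame_baseSet ∞ b i).mono inter_subset_right
  have ha (i) : CMDiff[U'] ∞ (a i) :=
    contMDiffOn_localFrameCoeff b hU' inter_subset_right (hσ.mono inter_subset_left) i
  -- Expand $\sigma$ in a local frame: $R$ is linear over functions, and the coefficients vanish at
  -- $x$.
  have hsum (t : Finset (Fin (Module.finrank ℝ F))) :
      CMDiff[U'] ∞ (T% (∑ i ∈ t, a i • s i)) ∧
        curvatureAt cov X Y (∑ i ∈ t, a i • s i) x = 0 := by
    induction t using Finset.induction_on with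
    | empty =>
      simp only [Finset.sum_empty]
      refine ⟨(contMDiff_zeroSection ℝ V).contMDiffOn, ?_⟩
      have hz (Z : ∀ y : M, TangentSpace I y) : (fun y ↦ cov 0 y (Z y)) = 0 := by
        rw [cov.zero]; rfl
      rw [curvatureAt, hz, hz, cov.zero]
      simp
    | insert i t hi ih =>
      rw [Finset.sum_insert hi]
      have h1 : CMDiff[U'] ∞ (T% (a i • s i)) := (ha i).smul_section (hs i)
      refine ⟨h1.add_section ih.1, ?_⟩
      rw [curvatureAt_add hcov hU' hX' hY' h1 ih.1 hx', ih.2,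
        curvatureAt_smul hcov hU' hX' hY' (hs i) (ha i) hx']
      simp [a, h0]
  rw [curvatureAt_congr hcov hU' hX' hY' (hsum Finset.univ).1 _ hx', (hsum Finset.univ).2]
  intro y hy
  rw [e.eq_sum_localFrameCoeff_smul (I := I) (s := σ) (b := b) hy.2]
  simp [a, s]

end Curvature

/-! ### The fibres of the derived flag -/

section FlagFibres

set_option maxSynthPendingDepth 3

variable {E : Type*} [NormedAddCommGroup E] [NormedSpace ℝ E]
  {H : Type*} [TopologicalSpace H] {I : ModelWithCorners ℝ E H}
  {M : Type*} [TopologicalSpace M] [ChartedSpace H M]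
  {F : Type*} [NormedAddCommGroup F] [NormedSpace ℝ F]
  {V : M → Type*} [TopologicalSpace (TotalSpace F V)]
  [∀ x, AddCommGroup (V x)] [∀ x, Module ℝ (V x)] [∀ x, TopologicalSpace (V x)]

/-- The fibres of a subset of a vector bundle are linear subspaces. -/
structure HasLinearFibres (A : ∀ x : M, Set (V x)) : Prop where
  zero_mem (x : M) : (0 : V x) ∈ A x
  add_mem {x : M} {v w : V x} : v ∈ A x → w ∈ A x → v + w ∈ A x
  smul_mem {x : M} (c : ℝ) {v : V x} : v ∈ A x → c • v ∈ A x

/-- The fibres as submodules. -/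
def HasLinearFibres.toSubmodule {A : ∀ x : M, Set (V x)} (hA : HasLinearFibres A) (x : M) :
    Submodule ℝ (V x) where
  carrier := A x
  zero_mem' := hA.zero_mem x
  add_mem' := hA.add_mem
  smul_mem' c _ := hA.smul_mem c

variable [∀ x, IsTopologicalAddGroup (V x)] [∀ x, ContinuousSMul ℝ (V x)] [FiberBundle F V]

lemma mem_sectionPart_of_mem {A : ∀ x : M, Set (V x)} {U : Set M} {σ : ∀ x : M, V x}
    (hσ : IsSmoothLocalSection I F A U σ) {x : M} (hx : x ∈ U) : σ x ∈ sectionPart I F A x :=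
  ⟨U, σ, hx, hσ, rfl⟩

variable [VectorBundle ℝ F V]

lemma IsSmoothLocalSection.add {A : ∀ x : M, Set (V x)} (hA : HasLinearFibres A) {U U' : Set M}
    {σ τ : ∀ x : M, V x} (hσ : IsSmoothLocalSection I F A U σ)
    (hτ : IsSmoothLocalSection I F A U' τ) : IsSmoothLocalSection I F A (U ∩ U') (σ + τ) :=
  ⟨hσ.1.inter hτ.1, (hσ.2.1.mono inter_subset_left).add_section (hτ.2.1.mono inter_subset_right),
    fun y hy ↦ hA.add_mem (hσ.2.2 y hy.1) (hτ.2.2 y hy.2)⟩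

lemma IsSmoothLocalSection.const_smul {A : ∀ x : M, Set (V x)} (hA : HasLinearFibres A)
    {U : Set M} {σ : ∀ x : M, V x} (hσ : IsSmoothLocalSection I F A U σ) (c : ℝ) :
    IsSmoothLocalSection I F A U (c • σ) :=
  ⟨hσ.1, hσ.2.1.const_smul_section, fun y hy ↦ hA.smul_mem c (hσ.2.2 y hy)⟩

lemma isSmoothLocalSection_zero {A : ∀ x : M, Set (V x)} (hA : HasLinearFibres A) :
    IsSmoothLocalSection I F A univ 0 :=
  ⟨isOpen_univ, (contMDiff_zeroSection ℝ V).contMDiffOn, fun y _ ↦ hA.zero_mem y⟩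

lemma HasLinearFibres.sectionPart {A : ∀ x : M, Set (V x)} (hA : HasLinearFibres A) :
    HasLinearFibres (sectionPart I F A) where
  zero_mem x := mem_sectionPart_of_mem (isSmoothLocalSection_zero hA) (mem_univ x)
  add_mem := by
    rintro x v w ⟨U, σ, hx, hσ, rfl⟩ ⟨U', τ, hx', hτ, rfl⟩
    exact mem_sectionPart_of_mem (hσ.add hA hτ) ⟨hx, hx'⟩
  smul_mem := by
    rintro x c v ⟨U, σ, hx, hσ, rfl⟩
    exact mem_sectionPart_of_mem (hσ.const_smul hA c) hx

variable [IsManifold I ∞ M] {cov : CovariantDerivative I F V}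

lemma HasLinearFibres.secondFundamentalKernel {A : ∀ x : M, Set (V x)} (hA : HasLinearFibres A) :
    HasLinearFibres (secondFundamentalKernel cov A) where
  zero_mem x := ⟨univ, 0, mem_univ x, isSmoothLocalSection_zero hA, rfl, fun v ↦ by
    rw [cov.zero]; exact hA.zero_mem x⟩
  add_mem := by
    rintro x v w ⟨U, σ, hx, hσ, rfl, hσ'⟩ ⟨U', τ, hx', hτ, rfl, hτ'⟩
    refine ⟨U ∩ U', σ + τ, ⟨hx, hx'⟩, hσ.add hA hτ, rfl, fun u ↦ ?_⟩
    rw [cov.isCovariantDerivativeOnUniv.add (hσ.2.1.mdifferentiableAt_section hσ.1 hx)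
      (hτ.2.1.mdifferentiableAt_section hτ.1 hx')]
    exact hA.add_mem (hσ' u) (hτ' u)
  smul_mem := by
    rintro x c v ⟨U, σ, hx, hσ, rfl, hσ'⟩
    refine ⟨U, c • σ, hx, hσ.const_smul hA c, rfl, fun u ↦ ?_⟩
    rw [cov.isCovariantDerivativeOnUniv.smul_const c (hσ.2.1.mdifferentiableAt_section hσ.1 hx)]
    exact hA.smul_mem c (hσ' u)

variable {W : ∀ x : M, Set (V x)}

/-- A section with values in $A$ automatically has values in $\mathcal S(A)$, so $\mathcal S$ is
idempotent. This makes the rank of each $W^{(i)}$ lower semicontinuous. -/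
lemma exists_section_of_mem_derivedFlag {i : ℕ} {x : M} {w : V x}
    (hw : w ∈ derivedFlag cov W i x) :
    ∃ (U : Set M) (σ : ∀ y : M, V y),
      x ∈ U ∧ IsSmoothLocalSection I F (derivedFlag cov W i) U σ ∧ σ x = w := by
  cases i with
  | zero =>
    obtain ⟨U, σ, hx, hσ, rfl⟩ := hw
    exact ⟨U, σ, hx, ⟨hσ.1, hσ.2.1, fun y hy ↦ mem_sectionPart_of_mem hσ hy⟩, rfl⟩
  | succ i =>
    obtain ⟨U, σ, hx, hσ, rfl⟩ := hw
    exact ⟨U, σ, hx, ⟨hσ.1, hσ.2.1, fun y hy ↦ mem_sectionPart_of_mem hσ hy⟩, rfl⟩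

variable [CompleteSpace E] [FiniteDimensional ℝ F] [ContMDiffVectorBundle ∞ F V I]

lemma curvatureAt_eq_of_apply_eq (hcov : IsSmoothConnection cov) {U : Set M}
    {X Y : ∀ y : M, TangentSpace I y} {σ τ : ∀ y : M, V y} {x : M} (hU : IsOpen U)
    (hX : CMDiff[U] ∞ (T% X)) (hY : CMDiff[U] ∞ (T% Y)) (hσ : CMDiff[U] ∞ (T% σ))
    (hτ : CMDiff[U] ∞ (T% τ)) (hx : x ∈ U) (h : σ x = τ x) :
    curvatureAt cov X Y σ x = curvatureAt cov X Y τ x := by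
  have h1 := curvatureAt_add hcov hU hX hY hτ (hσ.sub_section hτ) hx
  rw [add_sub_cancel] at h1
  rw [h1, curvatureAt_eq_zero_of_apply_eq_zero hcov hU hX hY (hσ.sub_section hτ) hx (by simp [h]),
    add_zero]

/-- By tensoriality, one extension $\sigma$ of the vector may be tested instead of all of them. -/
lemma mem_curvatureKernel_of_section (hcov : IsSmoothConnection cov)
    {U : Set M} (hU : IsOpen U) {σ : ∀ y : M, V y} (hσ : CMDiff[U] ∞ (T% σ)) {x : M} (hx : x ∈ U)
    (hW : σ x ∈ W x)
    (h : ∀ (U' : Set M) (X Y : ∀ y : M, TangentSpace I y), IsOpen U' → x ∈ U' → U' ⊆ U →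
      CMDiff[U'] ∞ (T% X) → CMDiff[U'] ∞ (T% Y) → curvatureAt cov X Y σ x = 0) :
    σ x ∈ curvatureKernel cov W x := by
  refine ⟨hW, fun U' X Y τ hU' hx' hX hY hτ hτx ↦ ?_⟩
  have hX' := hX.mono (inter_subset_right : U ∩ U' ⊆ U')
  have hY' := hY.mono (inter_subset_right : U ∩ U' ⊆ U')
  rw [curvatureAt_eq_of_apply_eq hcov (hU.inter hU') hX' hY' (hτ.mono inter_subset_right)
    (hσ.mono inter_subset_left) ⟨hx, hx'⟩ hτx]
  exact h _ X Y (hU.inter hU') ⟨hx, hx'⟩ inter_subset_left hX' hY'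

variable (I F) in
lemma exists_contMDiffOn_section {x : M} (w : V x) : ∃ (U : Set M) (σ : ∀ y : M, V y),
    IsOpen U ∧ x ∈ U ∧ CMDiff[U] ∞ (T% σ) ∧ σ x = w := by
  obtain ⟨s, hs, hsm⟩ := exists_contMDiffOn_extend (k := ∞) I F w
  obtain ⟨U, hUs, hU, hx⟩ := mem_nhds_iff.1 hs
  exact ⟨U, extend F w, hU, hx, hsm.mono hUs, extend_apply_self ..⟩

lemma HasLinearFibres.curvatureKernel (hcov : IsSmoothConnection cov)
    (hW : HasLinearFibres W) : HasLinearFibres (curvatureKernel cov W) where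
  zero_mem x := ⟨hW.zero_mem x, fun _ _ _ _ hU hx hX hY hσ h0 ↦
    curvatureAt_eq_zero_of_apply_eq_zero hcov hU hX hY hσ hx h0⟩
  add_mem := by
    rintro x v w hv hw
    obtain ⟨U, σ, hU, hx, hσ, rfl⟩ := exists_contMDiffOn_section I F v
    obtain ⟨U', τ, hU', hx', hτ, rfl⟩ := exists_contMDiffOn_section I F w
    have hσ' := hσ.mono (inter_subset_left : U ∩ U' ⊆ U)
    have hτ' := hτ.mono (inter_subset_right : U ∩ U' ⊆ U')
    refine mem_curvatureKernel_of_section (σ := σ + τ) hcov (hU.inter hU')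
      (hσ'.add_section hτ') ⟨hx, hx'⟩ (hW.add_mem hv.1 hw.1) fun Q X Y hQ hxQ hQU hX hY ↦ ?_
    rw [curvatureAt_add hcov hQ hX hY (hσ'.mono hQU) (hτ'.mono hQU) hxQ,
      hv.2 Q X Y σ hQ hxQ hX hY (hσ'.mono hQU) rfl, hw.2 Q X Y τ hQ hxQ hX hY (hτ'.mono hQU) rfl,
      add_zero]
  smul_mem := by
    rintro x c v hv
    obtain ⟨U, σ, hU, hx, hσ, rfl⟩ := exists_contMDiffOn_section I F v
    refine mem_curvatureKernel_of_section (σ := c • σ) hcov hU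
      hσ.const_smul_section hx (hW.smul_mem c hv.1) fun Q X Y hQ hxQ hQU hX hY ↦ ?_
    have h := curvatureAt_smul hcov hQ hX hY (hσ.mono hQU) (contMDiffOn_const (c := c)) hxQ
    rw [hv.2 Q X Y σ hQ hxQ hX hY (hσ.mono hQU) rfl, smul_zero] at h
    exact h

lemma hasLinearFibres_derivedFlag (hcov : IsSmoothConnection cov) (hW : HasLinearFibres W)
    (i : ℕ) : HasLinearFibres (derivedFlag cov W i) := by
  induction i with
  | zero => exact (hW.curvatureKernel hcov).sectionPart
  | succ i ih => exact ih.secondFundamentalKernel.sectionPart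

end FlagFibres

/-! ### The terminal subset is parallel where it is a vector bundle -/

section Terminal

lemma Submodule.eq_span_range_of_linearIndependent {V : Type*} [AddCommGroup V] [Module ℝ V]
    {S : Submodule ℝ V} {r : ℕ} {v : Fin r → V} (hv : LinearIndependent ℝ v) (hvS : ∀ j, v j ∈ S)
    (h : ¬ ∃ w : Fin (r + 1) → V, LinearIndependent ℝ w ∧ ∀ j, w j ∈ S) :
    S = Submodule.span ℝ (range v) := by
  refine le_antisymm (fun u hu ↦ ?_) (Submodule.span_le.2 (range_subset_iff.2 hvS))
  by_contra hn
  exact h ⟨Fin.cons u v, linearIndependent_finCons.2 ⟨hv, hn⟩, Fin.cases hu hvS⟩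

lemma not_exists_linearIndependent_of_mem_span {V : Type*} [AddCommGroup V] [Module ℝ V]
    {r : ℕ} (v : Fin r → V) :
    ¬ ∃ w : Fin (r + 1) → V, LinearIndependent ℝ w ∧ ∀ j, w j ∈ Submodule.span ℝ (range v) := by
  rintro ⟨w, hw, hwv⟩
  have := FiniteDimensional.span_of_finite ℝ (finite_range v)
  have h1 := finrank_span_eq_card hw
  have h2 := Submodule.finrank_mono (Submodule.span_le.2 (range_subset_iff.2 hwv))
  have h3 := finrank_range_le_card (R := ℝ) v
  rw [Set.finrank] at h3
  simp only [Fintype.card_fin] at h1 h3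
  omega

set_option maxSynthPendingDepth 3

variable {E : Type*} [NormedAddCommGroup E] [NormedSpace ℝ E]
  {H : Type*} [TopologicalSpace H] {I : ModelWithCorners ℝ E H}
  {M : Type*} [TopologicalSpace M] [ChartedSpace H M]
  {F : Type*} [NormedAddCommGroup F] [NormedSpace ℝ F]
  {V : M → Type*} [TopologicalSpace (TotalSpace F V)]
  [∀ x, AddCommGroup (V x)] [∀ x, Module ℝ (V x)] [∀ x, TopologicalSpace (V x)]
  [∀ x, IsTopologicalAddGroup (V x)] [∀ x, ContinuousSMul ℝ (V x)] [FiberBundle F V]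
  [VectorBundle ℝ F V]

/-- The rank of a subset spanned by smooth sections is lower semicontinuous. -/
lemma isOpen_setOf_exists_linearIndependent {A : ∀ x : M, Set (V x)}
    (hA : ∀ x, ∀ w ∈ A x, ∃ (U : Set M) (σ : ∀ y : M, V y),
      x ∈ U ∧ IsSmoothLocalSection I F A U σ ∧ σ x = w) (k : ℕ) :
    IsOpen {z : M | ∃ w : Fin k → V z, LinearIndependent ℝ w ∧ ∀ j, w j ∈ A z} := by
  refine isOpen_iff_mem_nhds.2 fun z ⟨w, hw, hwA⟩ ↦ ?_
  choose U σ hzU hσ hσw using fun j ↦ hA z (w j) (hwA j)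
  have h1 := eventually_linearIndependent_sections (σ := σ)
    (fun j ↦ (hσ j).2.1.contMDiffAt ((hσ j).1.mem_nhds (hzU j)))
    (by rwa [show (fun j ↦ σ j z) = w from funext hσw])
  have h2 : ∀ᶠ y in 𝓝 z, ∀ j, y ∈ U j :=
    Filter.eventually_all.2 fun j ↦ (hσ j).1.mem_nhds (hzU j)
  filter_upwards [h1, h2] with y h1 h2
  exact ⟨fun j ↦ σ j y, h1, fun j ↦ (hσ j).2.2 y (h2 j)⟩

variable [IsManifold I ∞ M] {cov : CovariantDerivative I F V} {W : ∀ x : M, Set (V x)}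
  [CompleteSpace E] [FiniteDimensional ℝ F] [ContMDiffVectorBundle ∞ F V I]

/-- A decreasing sequence of subspaces of a finite-dimensional fibre stabilizes. The index may
depend on the point. -/
lemma exists_derivedFlag_eq_terminalSubset (hcov : IsSmoothConnection cov)
    (hW : HasLinearFibres W) (z : M) :
    ∃ i, derivedFlag cov W i z = terminalSubset cov W z := by
  have : FiniteDimensional ℝ (V z) := VectorBundle.finiteDimensional ℝ F V z
  have hanti : Antitone fun i ↦ derivedFlag cov W i z :=
    antitone_nat_of_succ_le fun i ↦ derivedFlag_succ_subset cov W i z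
  obtain ⟨n, hn⟩ := IsArtinian.monotone_stabilizes (R := ℝ) (M := V z)
    ⟨fun i ↦ OrderDual.toDual ((hasLinearFibres_derivedFlag hcov hW i).toSubmodule z),
      fun i j hij ↦ hanti hij⟩
  refine ⟨n, Subset.antisymm (subset_iInter fun m ↦ ?_) (iInter_subset _ n)⟩
  rcases le_total n m with h | h
  · exact (congrArg (fun S : Submodule ℝ (V z) ↦ (S : Set (V z))) (hn m h)).subset
  · exact hanti h

/-- Where `W̃` is a vector bundle, every nonempty open set contains a nonempty open set on which
`W̃` coincides with some `W⁽ⁱ⁾`. -/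
lemma exists_isOpen_derivedFlag_eq_span [BaireSpace M] (hcov : IsSmoothConnection cov)
    (hW : HasLinearFibres W) {O : Set M} (hO : IsOpen O) (hne : O.Nonempty) {r : ℕ}
    {X : Fin r → ∀ z : M, V z} (hli : ∀ z ∈ O, LinearIndependent ℝ (fun j ↦ X j z))
    (hterm : ∀ z ∈ O, terminalSubset cov W z = Submodule.span ℝ (range fun j ↦ X j z)) :
    ∃ (Q : Set M) (i : ℕ), IsOpen Q ∧ Q.Nonempty ∧ Q ⊆ O ∧
      ∀ z ∈ Q, derivedFlag cov W i z = Submodule.span ℝ (range fun j ↦ X j z) := by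
  -- The closed set where $W^{(i)}$ has rank at most $r$. Adjoining the complement of `O` yields a
  -- countable closed cover of all of `M`, to which Baire's theorem applies.
  set C : ℕ → Set M := fun i ↦
    {z : M | ∃ w : Fin (r + 1) → V z, LinearIndependent ℝ w ∧ ∀ j, w j ∈ derivedFlag cov W i z}ᶜ
  have hC (i) : IsClosed (C i ∪ Oᶜ) :=
    (isOpen_setOf_exists_linearIndependent (fun x w hw ↦
      exists_section_of_mem_derivedFlag hw) (r + 1)).isClosed_compl.union hO.isClosed_compl
  have hcover : ⋃ i, (C i ∪ Oᶜ) = univ := by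
    refine eq_univ_of_forall fun z ↦ mem_iUnion.2 ?_
    by_cases hz : z ∈ O
    · obtain ⟨i, hi⟩ := exists_derivedFlag_eq_terminalSubset hcov hW z
      refine ⟨i, Or.inl ?_⟩
      rw [hterm z hz] at hi
      simp only [C, mem_compl_iff, mem_ofPred_eq, hi]
      exact not_exists_linearIndependent_of_mem_span _
    · exact ⟨0, Or.inr hz⟩
  obtain ⟨q, hqO, hq⟩ := (dense_iUnion_interior_of_closed hC hcover).inter_open_nonempty O hO hne
  obtain ⟨i, hi⟩ := mem_iUnion.1 hq
  refine ⟨O ∩ interior (C i ∪ Oᶜ), i, hO.inter isOpen_interior, ⟨q, hqO, hi⟩, inter_subset_left,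
    fun z ⟨hzO, hz⟩ ↦ ?_⟩
  have hzC : z ∈ C i := (interior_subset hz).resolve_right (not_not_intro hzO)
  have hX (j) : X j z ∈ derivedFlag cov W i z := by
    have : X j z ∈ terminalSubset cov W z := by
      rw [hterm z hzO]
      exact Submodule.subset_span (mem_range_self j)
    exact mem_iInter.1 this i
  have h := Submodule.eq_span_range_of_linearIndependent
    (S := (hasLinearFibres_derivedFlag hcov hW i).toSubmodule z) (hli z hzO) hX hzC
  exact congrArg (fun S : Submodule ℝ (V z) ↦ (S : Set (V z))) h

/-- Membership in $W^{(i+1)}$ supplies a section $\sigma$ of $W^{(i)}$ with $\sigma(z)=X_j(z)$ and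
$\nabla\sigma(z)$ in $W^{(i)}$. The difference $X_j-\sigma=\sum a_kX_k$ has coefficients vanishing
at $z$, so its derivative there is $\sum da_k\,X_k$. -/
lemma covariantDerivative_mem_span_of_derivedFlag_succ {Q : Set M} (hQ : IsOpen Q) {r : ℕ}
    {X : Fin r → ∀ z : M, V z} (hX : ∀ j, CMDiff[Q] ∞ (T% (X j)))
    (hli : ∀ z ∈ Q, LinearIndependent ℝ (fun j ↦ X j z)) {i : ℕ}
    (hi : ∀ z ∈ Q, derivedFlag cov W i z = Submodule.span ℝ (range fun j ↦ X j z))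
    {z : M} (hz : z ∈ Q) (j : Fin r) (hj : X j z ∈ derivedFlag cov W (i + 1) z)
    (v : TangentSpace I z) :
    cov (X j) z v ∈ Submodule.span ℝ (range fun j ↦ X j z) := by
  obtain ⟨U, τ, hzU, hτ, hτz⟩ := hj
  obtain ⟨U', σ, hzU', ⟨hU', hσ, hσA⟩, hσz, hσv⟩ := hτ.2.2 z hzU
  rw [hτz] at hσz
  set O := U' ∩ Q
  have hO : IsOpen O := hU'.inter hQ
  have hzO : z ∈ O := ⟨hzU', hz⟩
  have hXO (k) : CMDiff[O] ∞ (T% (X k)) := (hX k).mono inter_subset_right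
  have hσO : CMDiff[O] ∞ (T% σ) := hσ.mono inter_subset_left
  obtain ⟨a, ha, haσ⟩ := exists_contMDiffOn_coeff hO hXO (fun y hy ↦ hli y hy.2)
    ((hXO j).sub_section hσO) fun y hy ↦ by
      refine Submodule.sub_mem _ (Submodule.subset_span (mem_range_self j)) ?_
      have := hσA y hy.1
      rwa [hi y hy.2] at this
  have ha0 (k) : a k z = 0 := by
    refine Fintype.linearIndependent_iff.1 (hli z hz) (fun k ↦ a k z) ?_ k
    rw [← haσ z hzO, Pi.sub_apply, hσz, sub_self]
  have hXz := (hXO j).mdifferentiableAt_section hO hzO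
  have hσz' := hσO.mdifferentiableAt_section hO hzO
  have h1 : cov (∑ k, a k • X k) z = cov (X j - σ) z := by
    refine cov.congr_of_eqOn hO hzO (mdifferentiableAt_sub_section hXz hσz') fun y hy ↦ ?_
    rw [haσ y hy]
    simp
  have h2 := cov.sum_smul_apply Finset.univ (fun k ↦ (ha k).mdifferentiableAt_of_isOpen hO hzO)
    (fun k ↦ (hXO k).mdifferentiableAt_section hO hzO) v
  rw [h1, cov.sub_apply hXz hσz'] at h2
  have h3 : cov (X j) z v = cov σ z v +
      ∑ k, (a k z • cov (X k) z v + d% (a k) z v • X k z) := by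
    rw [← h2]; simp
  rw [h3]
  refine Submodule.add_mem _ ?_ (Submodule.sum_mem _ fun k _ ↦ ?_)
  · have := hσv v
    rwa [hi z hz] at this
  · rw [ha0, zero_smul, zero_add]
    exact Submodule.smul_mem _ _ (Submodule.subset_span (mem_range_self k))

/-- Where `W̃` is a vector bundle, it is parallel. -/
lemma covariantDerivative_mem_terminalSubset [BaireSpace M] (hcov : IsSmoothConnection cov)
    (hW : HasLinearFibres W) {U : Set M} (hU : IsOpen U) {r : ℕ}
    {X : Fin r → ∀ z : M, V z} (hX : ∀ j, CMDiff[U] ∞ (T% (X j)))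
    (hli : ∀ z ∈ U, LinearIndependent ℝ (fun j ↦ X j z))
    (hterm : ∀ z ∈ U, terminalSubset cov W z = Submodule.span ℝ (range fun j ↦ X j z))
    {Y : ∀ z : M, TangentSpace I z} (hY : CMDiff[U] ∞ (T% Y)) (j : Fin r) {z : M} (hz : z ∈ U) :
    cov (X j) z (Y z) ∈ Submodule.span ℝ (range fun j ↦ X j z) := by
  by_contra hn
  -- If $\nabla_YX_j$ left the span at $z$, these $r+1$ sections would be independent on a whole
  -- neighbourhood, hence also at a point where $\widetilde W$ locally equals one $W^{(i)}$; there
  -- the preceding lemma forbids it.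
  let σ : Fin (r + 1) → ∀ z : M, V z := Fin.cons (fun z ↦ cov (X j) z (Y z)) X
  have hσ (y : M) : (fun k ↦ σ k y) = Fin.cons (cov (X j) y (Y y)) (fun k ↦ X k y) := by
    funext k
    refine Fin.cases rfl (fun _ ↦ rfl) k
  have hev := eventually_linearIndependent_sections (I := I) (σ := σ) (y := z)
    (Fin.cases ((hcov U _ Y hU (hX j) hY).contMDiffAt (hU.mem_nhds hz))
      (fun k ↦ (hX k).contMDiffAt (hU.mem_nhds hz)))
    (by rw [hσ]; exact linearIndependent_finCons.2 ⟨hli z hz, hn⟩)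
  obtain ⟨O, hOs, hO, hzO⟩ := mem_nhds_iff.1 (Filter.inter_mem hev (hU.mem_nhds hz))
  obtain ⟨Q, i, hQ, ⟨q, hq⟩, hQO, hi⟩ := exists_isOpen_derivedFlag_eq_span hcov hW hO ⟨z, hzO⟩
    (fun y hy ↦ hli y (hOs hy).2) (fun y hy ↦ hterm y (hOs hy).2)
  have hQU : Q ⊆ U := fun y hy ↦ (hOs (hQO hy)).2
  have hXq : X j q ∈ derivedFlag cov W (i + 1) q := by
    have : X j q ∈ terminalSubset cov W q := by
      rw [hterm q (hQU hq)]
      exact Submodule.subset_span (mem_range_self j)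
    exact mem_iInter.1 this (i + 1)
  have hmem := covariantDerivative_mem_span_of_derivedFlag_succ hQ (fun k ↦ (hX k).mono hQU)
    (fun y hy ↦ hli y (hQU hy)) hi hq j hXq (Y q)
  have hliq : LinearIndependent ℝ (fun k ↦ σ k q) := (hOs (hQO hq)).1
  rw [hσ] at hliq
  exact (linearIndependent_finCons.1 hliq).2 hmem

end Terminal

/-! ### Parallel sections of a flat subbundle -/

section ParallelSections

set_option maxSynthPendingDepth 3

variable {E : Type*} [NormedAddCommGroup E] [NormedSpace ℝ E] [FiniteDimensional ℝ E]
  {H : Type*} [TopologicalSpace H] {I : ModelWithCorners ℝ E H}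
  {M : Type*} [TopologicalSpace M] [ChartedSpace H M] [IsManifold I ∞ M]
  {F : Type*} [NormedAddCommGroup F] [NormedSpace ℝ F] [FiniteDimensional ℝ F]
  {V : M → Type*} [TopologicalSpace (TotalSpace F V)]
  [∀ x, AddCommGroup (V x)] [∀ x, Module ℝ (V x)] [∀ x, TopologicalSpace (V x)]
  [∀ x, IsTopologicalAddGroup (V x)] [∀ x, ContinuousSMul ℝ (V x)] [FiberBundle F V]
  [VectorBundle ℝ F V]
  {cov : CovariantDerivative I F V} {U : Set M} {r : ℕ} {X : Fin r → ∀ z : M, V z} {x₀ : M}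

/-- The negative of the connection form of a parallel frame, in the preferred chart at `x₀`. -/
lemma exists_connectionForm (hcov : IsSmoothConnection cov) (hU : IsOpen U)
    (hUx : U ⊆ (extChartAt I x₀).source)
    (hX : ∀ j, CMDiff[U] ∞ (T% (X j))) (hli : ∀ z ∈ U, LinearIndependent ℝ (fun j ↦ X j z))
    (hpar : ∀ j v, ∀ z ∈ U, cov (X j) z (coordVectorField I x₀ v z) ∈
      Submodule.span ℝ (range fun j ↦ X j z)) :
    ∃ A : E → E →L[ℝ] (Fin r → ℝ) →L[ℝ] (Fin r → ℝ),
      ContDiffOn ℝ ∞ A ((extChartAt I x₀).target ∩ (extChartAt I x₀).symm ⁻¹' U) ∧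
      ∀ z ∈ U, ∀ v j, cov (X j) z (coordVectorField I x₀ v z) =
        -∑ k, A (extChartAt I x₀ z) v (Pi.single j 1) k • X k z := by
  set b := Module.finBasis ℝ E
  have hY (v : E) : CMDiff[U] ∞ (T% (coordVectorField I x₀ v)) :=
    (contMDiffOn_coordVectorField x₀ v).mono hUx
  choose Γ hΓ hΓX using fun (i : Fin (Module.finrank ℝ E)) j ↦
    exists_contMDiffOn_coeff hU hX hli (hcov U (X j) _ hU (hX j) (hY (b i)))
      (fun z hz ↦ hpar j (b i) z hz)
  -- The elementary tensors $(v,c)\mapsto v^i c_j e_k$, of which $A$ is a combination with the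
  -- negated smooth connection coefficients.
  let T (i : Fin (Module.finrank ℝ E)) (j k : Fin r) : E →L[ℝ] (Fin r → ℝ) →L[ℝ] (Fin r → ℝ) :=
    (LinearMap.toContinuousLinearMap (b.coord i)).smulRight
      ((ContinuousLinearMap.proj (R := ℝ) (φ := fun _ : Fin r ↦ ℝ) j).smulRight (Pi.single k 1))
  refine ⟨fun p ↦ -∑ i, ∑ j, ∑ k, Γ i j k ((extChartAt I x₀).symm p) • T i j k, ?_, ?_⟩
  · refine ContDiffOn.neg (ContDiffOn.sum fun i _ ↦ ContDiffOn.sum fun j _ ↦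
      ContDiffOn.sum fun k _ ↦ ?_)
    have h := contMDiffOn_iff_contDiffOn.1 ((hΓ i j k).comp
      ((contMDiffOn_extChartAt_symm x₀).mono inter_subset_left) fun p hp ↦ hp.2)
    exact h.smul contDiffOn_const
  · intro z hz v j
    have hv : coordVectorField I x₀ v z = ∑ i, b.repr v i • coordVectorField I x₀ (b i) z := by
      simp only [coordVectorField_apply]
      conv_lhs => rw [← b.sum_repr v]
      exact (map_sum _ _ _).trans (Finset.sum_congr rfl fun i _ ↦ map_smul _ _ _)
    have h1 : cov (X j) z (coordVectorField I x₀ v z) =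
        ∑ i, b.repr v i • ∑ k, Γ i j k z • X k z := by
      rw [hv, map_sum]
      refine Finset.sum_congr rfl fun i _ ↦ ?_
      rw [map_smul, ← hΓX i j z hz]
    have h2 (k : Fin r) : (-∑ i, ∑ j, ∑ k,
        Γ i j k ((extChartAt I x₀).symm (extChartAt I x₀ z)) • T i j k) v (Pi.single j 1) k =
          -∑ i, b.repr v i * Γ i j k z := by
      rw [(extChartAt I x₀).left_inv (hUx hz)]
      simp [T, Finset.sum_apply, Pi.single_apply, mul_comm]
    simp only [h2]
    rw [h1]
    simp only [neg_smul, Finset.sum_neg_distrib, neg_neg, Finset.sum_smul, Finset.smul_sum,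
      smul_smul]
    exact Finset.sum_comm

variable {A : E → E →L[ℝ] (Fin r → ℝ) →L[ℝ] (Fin r → ℝ)}

/-- With this choice of sign, $\sum f_kX_k$ is parallel exactly when $df(v)=A(v)f$. -/
lemma covariantDerivative_sum_smul_frame (hU : IsOpen U) (hX : ∀ j, CMDiff[U] ∞ (T% (X j)))
    (hA : ∀ z ∈ U, ∀ v j, cov (X j) z (coordVectorField I x₀ v z) =
        -∑ k, A (extChartAt I x₀ z) v (Pi.single j 1) k • X k z)
    {f : Fin r → M → ℝ} {z : M} (hz : z ∈ U) (hf : ∀ k, MDiffAt (f k) z) (v : E) :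
    cov (∑ k, f k • X k) z (coordVectorField I x₀ v z) =
      ∑ k, (d% (f k) z (coordVectorField I x₀ v z) -
        A (extChartAt I x₀ z) v (fun j ↦ f j z) k) • X k z := by
  rw [cov.sum_smul_apply Finset.univ hf (fun k ↦ (hX k).mdifferentiableAt_section hU hz)]
  have h1 (k : Fin r) : A (extChartAt I x₀ z) v (fun j ↦ f j z) k =
      ∑ j, f j z * A (extChartAt I x₀ z) v (Pi.single j 1) k := by
    conv_lhs => rw [pi_eq_sum_univ' (fun j ↦ f j z), map_sum]
    simp
  simp only [h1, hA z hz, sub_smul, Finset.sum_smul, Finset.sum_sub_distrib,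
    Finset.sum_add_distrib, smul_neg, Finset.sum_neg_distrib, Finset.smul_sum, smul_smul]
  rw [Finset.sum_comm]
  abel

/-- Coordinate fields commute, so on a combination of the frame with constant coefficients $c$ the
curvature consists of second covariant derivatives only. Its coefficients are the antisymmetrization
of $-(\partial_uA)(v)c+A(u)A(v)c$. -/
lemma connectionForm_flat (hU : IsOpen U)
    (hUx : U ⊆ (extChartAt I x₀).source) (hX : ∀ j, CMDiff[U] ∞ (T% (X j)))
    (hli : ∀ z ∈ U, LinearIndependent ℝ (fun j ↦ X j z))
    (hcurv : ∀ (c : Fin r → ℝ) (u v : E), ∀ z ∈ U, curvatureAt cov (coordVectorField I x₀ u)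
      (coordVectorField I x₀ v) (∑ k, (fun _ : M ↦ c k) • X k) z = 0)
    (hA : ∀ z ∈ U, ∀ v j, cov (X j) z (coordVectorField I x₀ v z) =
        -∑ k, A (extChartAt I x₀ z) v (Pi.single j 1) k • X k z)
    {z : M} (hz : z ∈ U) (hAz : DifferentiableAt ℝ A (extChartAt I x₀ z)) (u v : E)
    (c : Fin r → ℝ) :
    fderiv ℝ A (extChartAt I x₀ z) u v c +
        A (extChartAt I x₀ z) v (A (extChartAt I x₀ z) u c) =
      fderiv ℝ A (extChartAt I x₀ z) v u c +
        A (extChartAt I x₀ z) u (A (extChartAt I x₀ z) v c) := by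
  set p := extChartAt I x₀ z
  have hzx := hUx hz
  have hA' (v : E) (k : Fin r) : HasFDerivAt (fun q ↦ -A q v c k)
      (-((ContinuousLinearMap.proj (R := ℝ) (φ := fun _ : Fin r ↦ ℝ) k) ∘L
        ((ContinuousLinearMap.apply ℝ (Fin r → ℝ) c) ∘L
          ((ContinuousLinearMap.apply ℝ ((Fin r → ℝ) →L[ℝ] (Fin r → ℝ)) v) ∘L
            fderiv ℝ A p)))) p :=
    (((ContinuousLinearMap.proj (R := ℝ) (φ := fun _ : Fin r ↦ ℝ) k).hasFDerivAt.comp p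
      ((ContinuousLinearMap.apply ℝ (Fin r → ℝ) c).hasFDerivAt.comp p
        ((ContinuousLinearMap.apply ℝ ((Fin r → ℝ) →L[ℝ] (Fin r → ℝ)) v).hasFDerivAt.comp p
          hAz.hasFDerivAt)))).neg
  have hd (v : E) (k : Fin r) :
      MDiffAt (fun y : M ↦ -A (extChartAt I x₀ y) v c k) z :=
    MDifferentiableAt.comp (I' := 𝓘(ℝ, E)) (g := fun q ↦ -A q v c k) z
      (hA' v k).differentiableAt.mdifferentiableAt
      (mdifferentiableAt_extChartAt (by rwa [extChartAt_source] at hzx))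
  have hsec (u v : E) : cov (fun y ↦ cov (∑ k, (fun _ : M ↦ c k) • X k) y
        (coordVectorField I x₀ v y)) z (coordVectorField I x₀ u z) =
      ∑ k, (-fderiv ℝ A p u v c k + A p u (A p v c) k) • X k z := by
    have h1 : cov (fun y ↦ cov (∑ k, (fun _ : M ↦ c k) • X k) y (coordVectorField I x₀ v y)) z =
        cov (∑ k, (fun y ↦ -A (extChartAt I x₀ y) v c k) • X k) z := by
      refine cov.congr_of_eqOn hU hz ?_ fun y hy ↦ ?_
      · simp only [Finset.sum_fn]
        exact MDifferentiableAt.sum_section fun k _ ↦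
          (hd v k).smul_section ((hX k).mdifferentiableAt_section hU hz)
      · rw [covariantDerivative_sum_smul_frame hU hX hA hy (fun k ↦ mdifferentiableAt_const)]
        simp [mvfderiv_const]
    rw [h1, covariantDerivative_sum_smul_frame hU hX hA hz (hd v)]
    refine Finset.sum_congr rfl fun k _ ↦ ?_
    rw [mvfderiv_comp_extChartAt_coordVectorField hzx (hA' v k).differentiableAt,
      (hA' v k).fderiv]
    congr 1
    have e : (fun j ↦ -A (extChartAt I x₀ z) v c j) = -A p v c := rfl
    rw [e, map_neg]
    simp [p]
  have h := hcurv c u v z hz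
  rw [curvatureAt, mlieBracket_coordVectorField hzx, map_zero, sub_zero, hsec, hsec,
    ← Finset.sum_sub_distrib] at h
  simp only [← sub_smul] at h
  funext k
  have hk := Fintype.linearIndependent_iff.1 (hli z hz) _ h k
  simp only [Pi.add_apply]
  linarith

variable [I.Boundaryless]

/-- Through every element of a flat parallel subbundle there passes a parallel section. -/
lemma exists_parallel_section (hcov : IsSmoothConnection cov) (hU : IsOpen U)
    (hUx : U ⊆ (extChartAt I x₀).source) (hX : ∀ j, CMDiff[U] ∞ (T% (X j)))
    (hli : ∀ z ∈ U, LinearIndependent ℝ (fun j ↦ X j z))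
    (hpar : ∀ j v, ∀ z ∈ U, cov (X j) z (coordVectorField I x₀ v z) ∈
      Submodule.span ℝ (range fun j ↦ X j z))
    (hcurv : ∀ (c : Fin r → ℝ) (u v : E), ∀ z ∈ U, curvatureAt cov (coordVectorField I x₀ u)
      (coordVectorField I x₀ v) (∑ k, (fun _ : M ↦ c k) • X k) z = 0)
    {x : M} (hx : x ∈ U) {w : V x} (hw : w ∈ Submodule.span ℝ (range fun j ↦ X j x)) :
    ∃ (Q : Set M) (σ : ∀ z : M, V z), IsOpen Q ∧ x ∈ Q ∧ Q ⊆ U ∧ CMDiff[Q] ∞ (T% σ) ∧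
      σ x = w ∧ ∀ z ∈ Q, σ z ∈ Submodule.span ℝ (range fun j ↦ X j z) ∧ cov σ z = 0 := by
  obtain ⟨A, hA, hAX⟩ := exists_connectionForm hcov hU hUx hX hli hpar
  set φ := extChartAt I x₀
  set O : Set E := φ.target ∩ φ.symm ⁻¹' U
  have hO : IsOpen O :=
    (continuousOn_extChartAt_symm x₀).isOpen_inter_preimage (isOpen_extChartAt_target x₀) hU
  have hφ {z : M} (hz : z ∈ U) : φ z ∈ O :=
    ⟨φ.map_source (hUx hz), by rw [mem_preimage, φ.left_inv (hUx hz)]; exact hz⟩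
  have hflat : ∀ q ∈ O, ∀ u v f, fderiv ℝ A q u v f + A q v (A q u f) =
      fderiv ℝ A q v u f + A q u (A q v f) := by
    intro q hq u v f
    have hAq : DifferentiableAt ℝ A q :=
      (hA.contDiffAt (hO.mem_nhds hq)).differentiableAt (by simp)
    rw [← φ.right_inv hq.1] at hAq ⊢
    exact connectionForm_flat hU hUx hX hli hcurv hAX hq.2 hAq u v f
  obtain ⟨c, hc⟩ := (Submodule.mem_span_range_iff_exists_fun ℝ).1 hw
  -- The initial value `c` is the coefficient vector of `w` in the frame at `x`.
  obtain ⟨O', f, hO'O, hO', hxO', hf, hfx, hfA⟩ := exists_solution_of_flat hO hA hflat (hφ hx) c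
  set Q : Set M := φ.source ∩ φ ⁻¹' O'
  have hQ : IsOpen Q := (continuousOn_extChartAt x₀).isOpen_inter_preimage
    (isOpen_extChartAt_source x₀) hO'
  have hQU : Q ⊆ U := fun z hz ↦ by
    have := (hO'O hz.2).2
    rwa [mem_preimage, φ.left_inv hz.1] at this
  have hfk (k : Fin r) : CMDiff[Q] ∞ (fun z ↦ f (φ z) k) :=
    ((contDiffOn_pi.1 hf k).contMDiffOn.comp (contMDiffOn_extChartAt.mono fun z hz ↦ by
      rw [← extChartAt_source I]; exact hz.1) fun z hz ↦ hz.2)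
  refine ⟨Q, ∑ k, (fun z ↦ f (φ z) k) • X k, hQ, ⟨hUx hx, hxO'⟩, hQU, ?_, ?_, fun z hz ↦
    ⟨?_, ?_⟩⟩
  · simp only [Finset.sum_fn]
    exact ContMDiffOn.sum_section fun k _ ↦ (hfk k).smul_section ((hX k).mono hQU)
  · simp [← hc, hfx]
  · rw [Finset.sum_apply]
    exact Submodule.sum_mem _ fun k _ ↦
      Submodule.smul_mem _ _ (Submodule.subset_span (mem_range_self k))
  · ext1 v
    obtain ⟨v, rfl⟩ := exists_coordVectorField_eq hz.1 v
    rw [covariantDerivative_sum_smul_frame hU hX hAX (hQU hz)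
      (fun k ↦ (hfk k).mdifferentiableAt_of_isOpen hQ hz)]
    refine Finset.sum_eq_zero fun k _ ↦ ?_
    have hk : HasFDerivAt (fun q ↦ f q k) _ (φ z) :=
      hasFDerivAt_pi'.1 (hfA (φ z) hz.2) k
    rw [mvfderiv_comp_extChartAt_coordVectorField (g := fun q ↦ f q k) hz.1 hk.differentiableAt,
      hk.fderiv]
    simp [φ]

end ParallelSections

/-! ### Smoothness of the induced connection -/

section SmoothConnections

set_option maxSynthPendingDepth 3

variable {E : Type*} [NormedAddCommGroup E] [NormedSpace ℝ E] [FiniteDimensional ℝ E]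
  {H : Type*} [TopologicalSpace H] {I : ModelWithCorners ℝ E H}
  {M : Type*} [TopologicalSpace M] [ChartedSpace H M] [IsManifold I ∞ M]
  {F : Type*} [NormedAddCommGroup F] [NormedSpace ℝ F]
  {V : M → Type*} [TopologicalSpace (TotalSpace F V)]
  [∀ x, AddCommGroup (V x)] [∀ x, Module ℝ (V x)] [∀ x, TopologicalSpace (V x)]
  [∀ x, IsTopologicalAddGroup (V x)] [∀ x, ContinuousSMul ℝ (V x)] [FiberBundle F V]
  [VectorBundle ℝ F V]

/-- The hypothesis is applied to a global smooth section, so the local one is cut off by a bump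
function equal to $1$ near $y$; locality of `cov` shows that nothing changes there. -/
lemma isSmoothConnection_of_contMDiffCovariantDerivative [T2Space M]
    [ContMDiffVectorBundle ∞ F V I] {cov : CovariantDerivative I F V}
    (hcov : CovariantDerivative.ContMDiffCovariantDerivative cov ∞) : IsSmoothConnection cov := by
  intro U σ Y hU hσ hY y hy
  obtain ⟨ψ, -, hψ⟩ := (SmoothBumpFunction.nhds_basis_tsupport (I := I) y).mem_iff.1
    (hU.mem_nhds hy)
  have hs : CMDiff ∞ (T% ((ψ : M → ℝ) • σ)) :=
    ContMDiffOn.smul_section_of_tsupport ψ.contMDiff.contMDiffOn hU hψ hσ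
  have hglob := hcov.contMDiff.contMDiff hs.contMDiffOn
  have hUy := hU.mem_nhds hy
  refine ContMDiffAt.contMDiffWithinAt ?_
  have h1 : CMDiffAt ∞ (T% (fun z ↦ cov ((ψ : M → ℝ) • σ) z (Y z))) y :=
    ContMDiffAt.clm_bundle_apply (hglob.contMDiffAt Filter.univ_mem) (hY.contMDiffAt hUy)
  obtain ⟨O, hOs, hO, hyO⟩ := mem_nhds_iff.1 (Filter.inter_mem ψ.eventuallyEq_one hUy)
  refine h1.congr_of_eventuallyEq ?_
  filter_upwards [hO.mem_nhds hyO] with z hz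
  have h2 : cov ((ψ : M → ℝ) • σ) z = cov σ z := by
    refine cov.congr_of_eqOn hO hz (hσ.mdifferentiableAt_section hU (hOs hz).2) fun w hw ↦ ?_
    have : ψ w = 1 := (hOs hw).1
    simp [this]
  rw [h2]

variable {F' : Type*} [NormedAddCommGroup F'] [NormedSpace ℝ F'] [FiniteDimensional ℝ F]
  {V' : M → Type*} [TopologicalSpace (TotalSpace F' V')]
  [∀ x, AddCommGroup (V' x)] [∀ x, Module ℝ (V' x)] [∀ x, TopologicalSpace (V' x)]
  [∀ x, IsTopologicalAddGroup (V' x)] [∀ x, ContinuousSMul ℝ (V' x)] [FiberBundle F' V']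
  [VectorBundle ℝ F' V'] [ContMDiffVectorBundle ∞ F V I]

/-- A bundle homomorphism is smooth if it maps smooth local sections to smooth local sections. -/
lemma contMDiffOn_hom_of_apply {U : Set M} {φ : ∀ y : M, V y →L[ℝ] V' y}
    (h : ∀ (U' : Set M) (s : ∀ y : M, V y), IsOpen U' → U' ⊆ U → CMDiff[U'] ∞ (T% s) →
      CMDiff[U'] ∞ (T% (fun y ↦ φ y (s y)))) (hU : IsOpen U) :
    CMDiff[U] ∞ (fun y ↦ TotalSpace.mk' (F →L[ℝ] F') (E := fun y ↦ V y →L[ℝ] V' y) y (φ y)) := by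
  intro y hy
  refine ContMDiffAt.contMDiffWithinAt ((contMDiffAt_hom_bundle _).2 ⟨contMDiffAt_id, ?_⟩)
  set e := trivializationAt F V y
  set e' := trivializationAt F' V' y
  have hye : y ∈ e.baseSet := mem_baseSet_trivializationAt F V y
  have hye' : y ∈ e'.baseSet := mem_baseSet_trivializationAt F' V' y
  set b := Module.finBasis ℝ F
  have hb (T : F →L[ℝ] F') : T = ∑ i, ContinuousLinearMap.smulRightL ℝ F F'
      (LinearMap.toContinuousLinearMap (b.coord i)) (T (b i)) := by
    ext v
    conv_lhs => rw [← b.sum_repr v, map_sum]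
    simp
  have hs (i) : CMDiffAt ∞ (fun z ↦ (e' ⟨z, φ z (e.localFrame b i z)⟩).2) y := by
    have h1 := h (U ∩ e.baseSet) (e.localFrame b i) (hU.inter e.open_baseSet) inter_subset_left
      ((e.contMDiffOn_localFrame_baseSet ∞ b i).mono inter_subset_right)
    exact (contMDiffAt_section y).1 (h1.contMDiffAt
      ((hU.inter e.open_baseSet).mem_nhds ⟨hy, hye⟩))
  have hsum : CMDiffAt ∞ (fun z ↦ ∑ i, ContinuousLinearMap.smulRightL ℝ F F'
      (LinearMap.toContinuousLinearMap (b.coord i))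
      (e' ⟨z, φ z (e.localFrame b i z)⟩).2) y :=
    contMDiffAt_finsetSum fun i _ ↦ ContDiff.comp_contMDiffAt
      (ContinuousLinearMap.smulRightL ℝ F F'
        (LinearMap.toContinuousLinearMap (b.coord i))).contDiff (hs i)
  refine hsum.congr_of_eventuallyEq ?_
  filter_upwards [e.open_baseSet.mem_nhds hye, e'.open_baseSet.mem_nhds hye'] with z hz hz'
  rw [hb (ContinuousLinearMap.inCoordinates F V F' V' y z y z (φ z))]
  refine Finset.sum_congr rfl fun i _ ↦ ?_
  rw [ContinuousLinearMap.inCoordinates_eq hz hz']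
  have hi : e.localFrame b i z = (e.continuousLinearEquivAt ℝ z hz).symm (b i) := by
    rw [e.localFrame_apply_of_mem_baseSet b hz]
    simp only [Bundle.Trivialization.basisAt, Module.Basis.map_apply]
    rfl
  rw [hi]
  rfl

end SmoothConnections

/-! ### The tensor connection is smooth, and positive-definiteness is an open condition. -/

section PositiveDefinite

set_option maxSynthPendingDepth 3

variable {E : Type*} [NormedAddCommGroup E] [NormedSpace ℝ E] [FiniteDimensional ℝ E]

/-- By homogeneity only unit vectors matter, and the unit sphere is compact. -/
lemma eventually_forall_apply_self_pos {B : E →L[ℝ] E →L[ℝ] ℝ} (hB : ∀ v ≠ 0, 0 < B v v) :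
    ∀ᶠ B' in 𝓝 B, ∀ v ≠ 0, 0 < B' v v := by
  have h := (isCompact_sphere (0 : E) 1).eventually_forall_of_forall_eventually
    (x₀ := B) (P := fun B' v ↦ 0 < B' v v) fun v hv ↦ by
      have hc : Continuous fun z : (E →L[ℝ] E →L[ℝ] ℝ) × E ↦ z.1 z.2 z.2 := by fun_prop
      exact hc.continuousAt.eventually_const_lt (hB v (by rintro rfl; simp at hv))
  filter_upwards [h] with B' hB' v hv
  have h1 := hB' (‖v‖⁻¹ • v) (by simp [norm_smul, hv])
  simp only [map_smul, _root_.smul_apply, smul_eq_mul] at h1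
  have h2 : 0 < ‖v‖⁻¹ := by positivity
  exact pos_of_mul_pos_right (pos_of_mul_pos_right h1 h2.le) h2.le

variable {H : Type*} [TopologicalSpace H] {I : ModelWithCorners ℝ E H}
  {M : Type*} [TopologicalSpace M] [ChartedSpace H M] [IsManifold I ∞ M]
  {cov : CovariantDerivative I E (TangentSpace I : M → Type _)}

lemma ContMDiffOn.pairing {U : Set M} {h : ∀ y : M, BilinearFormAt I y}
    (hh : CMDiff[U] ∞ (fun y ↦ TotalSpace.mk' (E →L[ℝ] E →L[ℝ] ℝ) y (h y)))
    {Y Z : ∀ y : M, TangentSpace I y} (hY : CMDiff[U] ∞ (T% Y)) (hZ : CMDiff[U] ∞ (T% Z)) :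
    CMDiff[U] ∞ (fun y ↦ h y (Y y) (Z y)) := by
  intro y hy
  have : ContMDiffWithinAt I (I.prod 𝓘(ℝ)) ∞
      (fun m ↦ TotalSpace.mk' ℝ (E := Bundle.Trivial M ℝ) m (h m (Y m) (Z m))) U y := by
    apply ContMDiffWithinAt.clm_bundle_apply₂ (F₁ := E) (F₂ := E)
    · exact hh y hy
    · exact hY y hy
    · exact hZ y hy
  exact (contMDiffWithinAt_totalSpace.1 this).2

/-- A tensor is smooth once its values on smooth fields $P,Q$ are; the formula for
$(\nabla_Yh)(P,Q)$ involves smooth functions only. -/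
lemma isSmoothConnection_tensorConnection (hcov : IsSmoothConnection cov) :
    IsSmoothConnection (tensorConnection cov) := by
  intro U h Y hU hh hY
  refine contMDiffOn_hom_of_apply (F := E) (V := (TangentSpace I : M → Type _))
    (fun U' P hU' hUU' hP ↦ ?_) hU
  refine contMDiffOn_hom_of_apply (F := E) (V := (TangentSpace I : M → Type _)) (F' := ℝ)
    (V' := Bundle.Trivial M ℝ) (fun O Q hO hOU' hQ ↦ ?_) hU'
  have hhO := hh.mono (hOU'.trans hUU')
  have hYO := hY.mono (hOU'.trans hUU')
  have hPO := hP.mono hOU'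
  have key : CMDiff[O] ∞ (fun y ↦ tensorConnection cov h y (Y y) (P y) (Q y)) := by
    refine ContMDiffOn.congr (((ContMDiffOn.mvfderiv_apply hO (hhO.pairing hPO hQ) hYO).sub
      (hhO.pairing (hcov O P Y hO hPO hYO) hQ)).sub (hhO.pairing hPO (hcov O Q Y hO hQ hYO)))
      fun y hy ↦ ?_
    exact tensorConnection_apply cov (hhO.mdifferentiableAt_section hO hy) (Y y)
      (hPO.mdifferentiableAt_section hO hy) (hQ.mdifferentiableAt_section hO hy)
  intro y hy
  exact contMDiffWithinAt_totalSpace.2 ⟨contMDiffWithinAt_id, key y hy⟩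

lemma hasLinearFibres_symmetricForms : HasLinearFibres (symmetricForms I M) where
  zero_mem _ _ _ := rfl
  add_mem hv hw a b := congrArg₂ (· + ·) (hv a b) (hw a b)
  smul_mem c _ hv a b := congrArg (c * ·) (hv a b)

lemma eventually_isPositiveDefinite {x : M} {g : ∀ y : M, BilinearFormAt I y}
    (hg : CMDiffAt ∞ (fun y ↦ TotalSpace.mk' (E →L[ℝ] E →L[ℝ] ℝ) y (g y)) x)
    (hx : IsPositiveDefinite (g x)) : ∀ᶠ y in 𝓝 x, IsPositiveDefinite (g y) := by
  have hG := ((contMDiffAt_hom_bundle _).1 hg).2.continuousAt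
  -- `G` is $g$ read in the trivialization at $x$, with values in the forms on the fixed space $E$,
  -- where openness is already known.
  set G : M → E →L[ℝ] E →L[ℝ] ℝ := fun y ↦ ContinuousLinearMap.inCoordinates E (TangentSpace I)
    (E →L[ℝ] ℝ) (fun y : M ↦ TangentSpace I y →L[ℝ] ℝ) x y x y (g y)
  set e := trivializationAt E (TangentSpace I) x
  have hxe : x ∈ e.baseSet := mem_baseSet_trivializationAt E (TangentSpace I) x
  have hGe (y : M) (hy : y ∈ e.baseSet) (v w : TangentSpace I y) :
      G y (e ⟨y, v⟩).2 (e ⟨y, w⟩).2 = g y v w := by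
    have h := inCoordinates_apply_eq₂ (F₁ := E) (F₂ := E) (F₃ := ℝ)
      (E₁ := (TangentSpace I : M → Type _)) (E₂ := (TangentSpace I : M → Type _))
      (E₃ := Bundle.Trivial M ℝ) (x₀ := x) (ϕ := g y) (v := (e ⟨y, v⟩).2) (w := (e ⟨y, w⟩).2)
      hy hy (mem_univ y)
    rw [e.symm_apply_apply_mk hy, e.symm_apply_apply_mk hy] at h
    refine Eq.trans h ?_
    simp
  have hpos : ∀ v ≠ 0, 0 < G x v v := by
    intro v hv
    have hv' : (e ⟨x, e.symm x v⟩).2 = v := by rw [e.apply_mk_symm hxe]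
    have h0 : e.symm x v ≠ 0 := fun h0 ↦ hv (by
      rw [← hv', h0]; exact map_zero (e.linearEquivAt ℝ x hxe))
    rw [← hv', hGe x hxe]
    exact hx _ h0
  filter_upwards [hG.eventually (eventually_forall_apply_self_pos hpos),
    e.open_baseSet.mem_nhds hxe] with y hy hye v hv
  rw [← hGe y hye]
  refine hy _ fun h0 ↦ hv ?_
  exact (e.linearEquivAt ℝ y hye).map_eq_zero_iff.1 h0

end PositiveDefinite


/-! ### Parallel sections and the terminal subset -/

section ParallelTerminal

set_option maxSynthPendingDepth 3

variable {E : Type*} [NormedAddCommGroup E] [NormedSpace ℝ E] [FiniteDimensional ℝ E]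
  {H : Type*} [TopologicalSpace H] {I : ModelWithCorners ℝ E H}
  {M : Type*} [TopologicalSpace M] [ChartedSpace H M] [IsManifold I ∞ M]
  {F : Type*} [NormedAddCommGroup F] [NormedSpace ℝ F] [FiniteDimensional ℝ F]
  {V : M → Type*} [TopologicalSpace (TotalSpace F V)]
  [∀ x, AddCommGroup (V x)] [∀ x, Module ℝ (V x)] [∀ x, TopologicalSpace (V x)]
  [∀ x, IsTopologicalAddGroup (V x)] [∀ x, ContinuousSMul ℝ (V x)] [FiberBundle F V]
  [VectorBundle ℝ F V]
  {cov : CovariantDerivative I F V} {W : ∀ x : M, Set (V x)}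

lemma terminalSubset_subset_curvatureKernel (x : M) :
    terminalSubset cov W x ⊆ curvatureKernel cov W x := by
  intro w hw
  obtain ⟨U, σ, hx, hσ, rfl⟩ := mem_iInter.1 hw 0
  exact hσ.2.2 x hx

variable [ContMDiffVectorBundle ∞ F V I]

/-- The values of parallel sections lie in `W̃`. -/
lemma mem_terminalSubset_of_parallel (hcov : IsSmoothConnection cov) (hW : HasLinearFibres W)
    {U : Set M} (hU : IsOpen U) {σ : ∀ y : M, V y} (hσ : CMDiff[U] ∞ (T% σ))
    (hσW : ∀ y ∈ U, σ y ∈ W y) (hpar : ∀ y ∈ U, cov σ y = 0) {x : M} (hx : x ∈ U) :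
    σ x ∈ terminalSubset cov W x := by
  have h0 : ∀ y ∈ U, σ y ∈ curvatureKernel cov W y := fun y hy ↦ by
    refine mem_curvatureKernel_of_section hcov hU hσ hy (hσW y hy) fun O X Y hO hyO hOU _ _ ↦ ?_
    have hz (Z : ∀ y : M, TangentSpace I y) : cov (fun y ↦ cov σ y (Z y)) y = 0 := by
      rw [cov.congr_of_eqOn (τ := 0) hU hy (mdifferentiableAt_zeroSection ..) fun z hz ↦ by
        rw [hpar z hz]; rfl, cov.zero]
      rfl
    rw [curvatureAt, hz, hz, hpar y hy]
    simp
  refine mem_iInter.2 fun i ↦ ?_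
  suffices h : ∀ y ∈ U, σ y ∈ derivedFlag cov W i y from h x hx
  induction i with
  | zero => exact fun y hy ↦ mem_sectionPart_of_mem ⟨hU, hσ, h0⟩ hy
  | succ i ih =>
    refine fun y hy ↦ mem_sectionPart_of_mem ⟨hU, hσ, fun z hz ↦ ?_⟩ hy
    refine ⟨U, σ, hz, ⟨hU, hσ, ih⟩, rfl, fun v ↦ ?_⟩
    rw [hpar z hz]
    exact (hasLinearFibres_derivedFlag hcov hW i).zero_mem z

variable [I.Boundaryless] [T2Space M]

/-- If the connection is regular at `x`, there passes a parallel section of `W̃` through every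
element of the fibre of `W̃` at `x`. -/
lemma exists_parallel_section_of_isRegularConnectionAt (hcov : IsSmoothConnection cov)
    (hW : HasLinearFibres W) {x : M} (hreg : IsRegularConnectionAt cov W x) {w : V x}
    (hw : w ∈ terminalSubset cov W x) :
    ∃ (Q : Set M) (σ : ∀ z : M, V z), IsOpen Q ∧ x ∈ Q ∧ CMDiff[Q] ∞ (T% σ) ∧
      σ x = w ∧ ∀ z ∈ Q, σ z ∈ terminalSubset cov W z ∧ cov σ z = 0 := by
  -- Together with the Hausdorff property this makes `M` a Baire space.
  have : LocallyCompactSpace M := Manifold.locallyCompact_of_finiteDimensional I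
  obtain ⟨U₀, hU₀, hxU₀, hbundle⟩ := hreg
  obtain ⟨U', r, X, hU', hxU', hX', hXU'⟩ := hbundle x hxU₀
  set U := U' ∩ (extChartAt I x).source
  have hU : IsOpen U := hU'.inter (isOpen_extChartAt_source x)
  have hxU : x ∈ U := ⟨hxU', mem_extChartAt_source x⟩
  have hX (j) : CMDiff[U] ∞ (T% (X j)) := (hX' j).mono inter_subset_left
  have hli (z) (hz : z ∈ U) := (hXU' z hz.1).1
  have hterm (z) (hz : z ∈ U) := (hXU' z hz.1).2
  have hY (v : E) : CMDiff[U] ∞ (T% (coordVectorField I x v)) :=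
    (contMDiffOn_coordVectorField x v).mono inter_subset_right
  rw [hterm x hxU] at hw
  obtain ⟨Q, σ, hQ, hxQ, hQU, hσ, hσx, hσQ⟩ := exists_parallel_section hcov hU inter_subset_right
    hX hli (fun j v z hz ↦
      covariantDerivative_mem_terminalSubset hcov hW hU hX hli hterm (hY v) j hz)
    (fun c u v z hz ↦ by
      have hmem : (∑ k, (fun _ : M ↦ c k) • X k) z ∈ terminalSubset cov W z := by
        rw [hterm z hz, Finset.sum_apply]
        exact Submodule.sum_mem _ fun k _ ↦
          Submodule.smul_mem _ _ (Submodule.subset_span (mem_range_self k))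
      refine (terminalSubset_subset_curvatureKernel z hmem).2 U _ _ _ hU hz (hY u) (hY v) ?_ rfl
      simp only [Finset.sum_fn]
      exact ContMDiffOn.sum_section fun k _ ↦ contMDiffOn_const.smul_section (hX k)) hxU hw
  refine ⟨Q, σ, hQ, hxQ, hσ, hσx, fun z hz ↦ ⟨?_, (hσQ z hz).2⟩⟩
  rw [hterm z (hQU hz)]
  exact (hσQ z hz).1

end ParallelTerminal

/-! ### The criterion for a regular connection to be locally metric. -/

set_option maxSynthPendingDepth 3 in
lemma isLocallyMetricAt_iff_of_isRegularConnectionAt {E : Type*} [NormedAddCommGroup E]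
    [NormedSpace ℝ E] [FiniteDimensional ℝ E] {H : Type*} [TopologicalSpace H]
    {I : ModelWithCorners ℝ E H} [I.Boundaryless] {M : Type*} [TopologicalSpace M] [T2Space M]
    [ChartedSpace H M] [IsManifold I ∞ M]
    {cov : CovariantDerivative I E (TangentSpace I : M → Type _)}
    (hcov : IsSmoothConnection cov) {x : M}
    (hreg : IsRegularConnectionAt (tensorConnection cov) (symmetricForms I M) x) :
    IsLocallyMetricAt cov x ↔
      ∃ h ∈ terminalSubset (tensorConnection cov) (symmetricForms I M) x,
        IsPositiveDefinite h := by
  have hcov' := isSmoothConnection_tensorConnection hcov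
  constructor
  · rintro ⟨U, g, hU, hx, hg, hgU⟩
    exact ⟨g x, mem_terminalSubset_of_parallel hcov' hasLinearFibres_symmetricForms hU hg
      (fun y hy ↦ (hgU y hy).1) (fun y hy ↦ (hgU y hy).2.2) hx, (hgU x hx).2.1⟩
  · rintro ⟨h, hh, hpos⟩
    obtain ⟨Q, g, hQ, hxQ, hg, rfl, hgQ⟩ := exists_parallel_section_of_isRegularConnectionAt hcov'
      hasLinearFibres_symmetricForms hreg hh
    -- Shrink the domain of the parallel section so that it stays positive definite.
    obtain ⟨U, hUs, hU, hx⟩ := mem_nhds_iff.1 (Filter.inter_mem (hQ.mem_nhds hxQ)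
      (eventually_isPositiveDefinite (hg.contMDiffAt (hQ.mem_nhds hxQ)) hpos))
    have hUQ : U ⊆ Q := fun y hy ↦ (hUs hy).1
    refine ⟨U, g, hU, hx, hg.mono hUQ, fun y hy ↦ ⟨?_, (hUs hy).2, (hgQ y (hUQ hy)).2⟩⟩
    exact (terminalSubset_subset_curvatureKernel y (hgQ y (hUQ hy)).1).1

end

theorem corollary3 {n : ℕ} {M : Type*} [TopologicalSpace M] [T2Space M]
    [ChartedSpace (EuclideanSpace ℝ (Fin n)) M] [IsManifold (𝓡 n) ∞ M]
    (cov : CovariantDerivative (𝓡 n) (EuclideanSpace ℝ (Fin n)) (TangentSpace (𝓡 n) : M → Type _))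
    (hcov : CovariantDerivative.ContMDiffCovariantDerivative cov ∞) (x : M)
    (hreg : IsRegularConnectionAt (tensorConnection cov) (symmetricForms (𝓡 n) M) x) :
    IsLocallyMetricAt cov x ↔
      ∃ h ∈ terminalSubset (tensorConnection cov) (symmetricForms (𝓡 n) M) x,
        IsPositiveDefinite h := by
  exact isLocallyMetricAt_iff_of_isRegularConnectionAt
    (isSmoothConnection_of_contMDiffCovariantDerivative hcov) hreg
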